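/- Let $(R,\mathfrak m)$ be a commutative local ring whose maximal ideal is principal, $\mathfrak m=(r)$, with $\mathfrak m^2=0$ and $\mathfrak m\neq 0$ (for instance $\mathbb Z/p^2$, $p$ prime, or $k[X]/(X^2)$, $k$ a field). Chain complexes are non-negatively graded complexes of $R$-modules. For a complex $A$, let $\mathcal C(A)$ be the smallest collection of complexes that contains $A$, is closed under arbitrary direct sums and under weak equivalences (homology isomorphisms), and contains $Z$ whenever $0\to X\to Y\to Z\to 0$ is exact and $X,Y$ belong to it; write $X\gg A$ if $X\in\mathcal C(A)$. A complex $X$ is perfect if every $X_n$ is projective and $\bigoplus_n X_n$ is finitely generated. For integers $i,j\ge 0$ let $\Sigma^iE_j$ be the complex with $R$ in degrees $i\le n\le i+j$ and $0$ in all other degrees, whose differentials between adjacent copies of $R$ are multiplication by $(-1)^i r$. Order pairs of non-negative integers lexicographically: $(i,j)\le(i',j')$ if $i<i'$, or $i=i'$ and $j\le j'$. 1. For all $i,j,i',j'\ge 0$: $\Sigma^{i'}E_{j'}\gg\Sigma^iE_j$ if and only if $(i,j)\le(i',j')$. 2. Every perfect complex $X$ has a splitting $X\cong P\oplus\bigoplus_{a=1}^N\Sigma^{i_a}E_{j_a}$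 with $P$ acyclic and $N\ge 0$ finite. If $X$ is not contractible, there is a pair $(i_X,j_X)$ that is, for every such splitting of $X$, the minimal element of $\{(i_1,j_1),\dots,(i_N,j_N)\}$ (in particular $N\ge 1$), and $$\mathcal C(X)=\mathcal C(\Sigma^{i_X}E_{j_X}).$$ 3. If $X$ is perfect and contractible, then $\mathcal C(X)=\mathcal C(0)$. -/

import Mathlib

open CategoryTheory CategoryTheory.Limits
open scoped ZeroObject

universe u

/-- Non-negatively graded chain complexes of `R`-modules. -/
abbrev Ch (R : Type u) [CommRing R] : Type (u + 1) :=
  ChainComplex (ModuleCat.{u} R) ℕ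

/-- `IsCellular A X` means `X ≫ A`: the complex `X` lies in the smallest collection of complexes
that contains `A`, is closed under weak equivalences (quasi-isomorphisms, in both directions) and
arbitrary direct sums, and contains the last term of every short exact sequence whose first two
terms it contains. -/
inductive IsCellular {R : Type u} [CommRing R] (A : Ch R) : Ch R → Prop
  | self : IsCellular A A
  | sum {ι : Type u} (X : ι → Ch R) (hX : ∀ a, IsCellular A (X a)) : IsCellular A (∐ X)
  | of_source {X Y : Ch R} (f : X ⟶ Y) (hf : QuasiIso f) (hX : IsCellular A X) : IsCellular A Y
  | of_target {X Y : Ch R} (f : X ⟶ Y) (hf : QuasiIso f) (hY : IsCellular A Y) : IsCellular A X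
  | quotient (S : ShortComplex (Ch R)) (hS : S.ShortExact)
      (h₁ : IsCellular A S.X₁) (h₂ : IsCellular A S.X₂) : IsCellular A S.X₃

/-- The cellular class `C(A)`. -/
def cellularClass {R : Type u} [CommRing R] (A : Ch R) : Set (Ch R) :=
  {X | IsCellular A X}

/-- A perfect complex: every term is projective and the direct sum of all terms is finitely
generated. -/
def IsPerfect {R : Type u} [CommRing R] (X : Ch R) : Prop :=
  (∀ n, Module.Projective R (X.X n)) ∧ Module.Finite R (DirectSum ℕ fun n => X.X n)

/-- A contractible complex: the identity is homotopic to zero. -/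
def IsContractible {R : Type u} [CommRing R] (X : Ch R) : Prop :=
  Nonempty (Homotopy (𝟙 X) 0)

/-- The differential from degree `n + 1` to degree `n` of `Σ^i E_j`. The term in degree `n` is
the module of functions to `R` from the proof type of `i ≤ n ∧ n ≤ i + j`: a copy of `R` if these
inequalities hold and the zero module otherwise. -/
def sigmaEDiff {R : Type u} [CommRing R] (r : R) (i j n : ℕ) :
    (PLift (i ≤ n + 1 ∧ n + 1 ≤ i + j) → R) →ₗ[R] (PLift (i ≤ n ∧ n ≤ i + j) → R) where
  toFun f := fun _ => if h : i ≤ n + 1 ∧ n + 1 ≤ i + j then (-1) ^ i * r * f ⟨h⟩ else 0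
  map_add' f g := by
    ext
    dsimp
    split_ifs
    · exact mul_add _ _ _
    · exact (add_zero 0).symm
  map_smul' a f := by
    ext
    dsimp
    split_ifs
    · exact mul_left_comm _ _ _
    · exact (mul_zero a).symm

theorem sigmaEDiff_comp {R : Type u} [CommRing R] (r : R) (hr : r * r = 0) (i j n : ℕ) :
    (sigmaEDiff r i j n).comp (sigmaEDiff r i j (n + 1)) = 0 := by
  refine LinearMap.ext fun f => funext fun _ => ?_
  simp only [sigmaEDiff, LinearMap.comp_apply, LinearMap.coe_mk, AddHom.coe_mk,
    LinearMap.zero_apply, Pi.zero_apply]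
  split_ifs with h₁ h₂
  · linear_combination ((-1) ^ i * (-1) ^ i * f ⟨h₂⟩) * hr
  · exact mul_zero _
  · rfl

/-- The complex `Σ^i E_j`: it is `R` in degrees `i, …, i + j` and zero elsewhere, and its
differentials are multiplication by `(-1)^i r`. -/
noncomputable def sigmaE {R : Type u} [CommRing R] (r : R) (hr : r * r = 0) (i j : ℕ) : Ch R :=
  ChainComplex.of (fun n => ModuleCat.of R (PLift (i ≤ n ∧ n ≤ i + j) → R))
    (fun n => ModuleCat.ofHom (sigmaEDiff r i j n))
    (fun n => by
      rw [← ModuleCat.ofHom_comp, sigmaEDiff_comp r hr i j n]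
      rfl)

/-- A splitting `X ≅ P ⊕ Σ^{i₁} E_{j₁} ⊕ ⋯ ⊕ Σ^{i_N} E_{j_N}` with `P` acyclic. Pairs carry the
lexicographic order. -/
structure Splitting {R : Type u} [CommRing R] (r : R) (hr : r * r = 0) (X : Ch R) where
  P : Ch R
  acyclic : P.Acyclic
  N : ℕ
  pair : Fin N → ℕ ×ₗ ℕ
  iso : X ≅ P ⊞ ∐ fun a => sigmaE r hr (ofLex (pair a)).1 (ofLex (pair a)).2

/-- The set of pairs `(i, j)` such that `Σ^i E_j` appears in a given splitting. -/
def Splitting.pairs {R : Type u} [CommRing R] {r : R} {hr : r * r = 0} {X : Ch R}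
    (s : Splitting r hr X) : Set (ℕ ×ₗ ℕ) :=
  Set.range s.pair

theorem generator_mul_self {R : Type u} [CommRing R] [IsLocalRing R] {r : R}
    (hr : IsLocalRing.maximalIdeal R = Ideal.span {r})
    (hsq : IsLocalRing.maximalIdeal R ^ 2 = ⊥) : r * r = 0 := by
  rw [hr, Ideal.span_singleton_pow, Ideal.span_singleton_eq_bot] at hsq
  rw [← sq, hsq]

/-! ### Homology, acyclicity and exactness in terms of elements -/

section Elementwise

variable {R : Type u} [CommRing R]

/-! Write `bar` for the complexes `Σ^i E_j` without signs; rescaling the bases identifies the two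
families. For existence in part 1, three short exact sequences suffice. The cone of the identity of
`Σ^i E_j` is acyclic with quotient `Σ^{i+1} E_j` (`bar_shift`). Attaching `R` on top of `Σ^i E_j`
presents `Σ^i E_{j+1}` as a quotient of a complex equivalent to `Σ^i E_j` by `Σ^{i+j} E_0`
(`bar_succ`). For `j ≥ 1`, the quotient of a complex equivalent to `Σ^{i+1} E_j` by `Σ^i E_j` is
`R[i+1] ⊕ R[i+j+1]` with zero differential, whose first summand is `Σ^{i+1} E_0` (`bar_zero_succ`).
Cellular classes contain retracts by an Eilenberg swindle, so together these climb the lexicographic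
order.

For the converse, `HasChains r i j` is an invariant: no homology below `i`, and every cycle of
degree `i` extends to a map from `Σ^i E_j`. It survives every closure operation
(`IsCellular.hasChains`) and holds for `Σ^i E_j`. It fails for `Σ^{i'} E_{j'}` with a smaller pair,
since its bottom generator either would have to be a boundary or starts a chain that is too long.

For part 2, a differential not contained in `rX` has a unit entry, and an acyclic disc splits off.
If all differentials lie in `rX`, an element of top degree outside `rX` generates, on dividing
differentials by `r`, a copy of some `Σ^i E_j`. Functionals built upwards by projectivity retract
`X` onto it. Induction on total rank gives the splitting. Then `X` and its minimal summand build
each other, and part 1 recovers the minimal pair from the cellular class, so it does not depend on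
the splitting. -/

theorem ModuleCat.exists_cover_lift {A M N : ModuleCat.{u} R} (x : A ⟶ M) (f : N ⟶ M)
    (h : ∀ a, ∃ b, x a = f b) :
    ∃ (A' : ModuleCat.{u} R) (π : A' ⟶ A) (_ : Epi π) (y : A' ⟶ N), π ≫ x = y ≫ f := by
  choose g hg using h
  refine ⟨ModuleCat.of R (A →₀ R), ModuleCat.ofHom (Finsupp.linearCombination R id), ?_,
    ModuleCat.ofHom (Finsupp.linearCombination R g), ?_⟩
  · rw [ModuleCat.epi_iff_surjective]
    exact fun a => ⟨Finsupp.single a 1, by simp⟩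
  · ext a
    simp [hg]

theorem ModuleCat.exists_eq_of_cover_lift {M N : ModuleCat.{u} R} {x : M} {f : N ⟶ M}
    {A' : ModuleCat.{u} R} {π : A' ⟶ ModuleCat.of R R} (hπ : Epi π) {y : A' ⟶ N}
    (h : π ≫ ModuleCat.ofHom (LinearMap.toSpanSingleton R M x) = y ≫ f) : ∃ b, x = f b := by
  rw [ModuleCat.epi_iff_surjective] at hπ
  obtain ⟨a, ha⟩ := hπ (1 : R)
  refine ⟨y a, ?_⟩
  have := congr($h a)
  simpa [ha] using this

/-- Truncated subtraction is harmless: for `n = 0` the map `d 0 0` vanishes, so `d n (n - 1) x = 0`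
describes the cycles in every degree. -/
theorem ChainComplex.next_nat (n : ℕ) : (ComplexShape.down ℕ).next n = n - 1 := by
  cases n <;> simp

theorem ChainComplex.prev_nat (n : ℕ) : (ComplexShape.down ℕ).prev n = n + 1 := by
  simp

theorem Ch.d_d_apply (X : Ch R) (i j k : ℕ) (x : X.X i) : X.d j k (X.d i j x) = 0 := by
  rw [← ModuleCat.comp_apply, X.d_comp_d]
  rfl

theorem Ch.hom_d_apply {X Y : Ch R} (f : X ⟶ Y) (i j : ℕ) (x : X.X i) :
    f.f j (X.d i j x) = Y.d i j (f.f i x) := by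
  rw [← ModuleCat.comp_apply, ← f.comm]
  rfl

theorem Ch.mono_homologyMap_iff {X Y : Ch R} (f : X ⟶ Y) (n : ℕ) :
    Mono (HomologicalComplex.homologyMap f n) ↔
      ∀ x : X.X n, X.d n (n - 1) x = 0 → ∀ y : Y.X (n + 1), f.f n x = Y.d (n + 1) n y →
        ∃ x', x = X.d (n + 1) n x' := by
  rw [HomologicalComplex.mono_homologyMap_iff_up_to_refinements f (n + 1) n (n - 1)
    (ChainComplex.prev_nat n) (ChainComplex.next_nat n)]
  constructor
  · intro h x hx y hy
    obtain ⟨A', π, hπ, x₁, h₁⟩ := h (ModuleCat.ofHom (LinearMap.toSpanSingleton R _ x))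
      (by ext; simp [hx]) (ModuleCat.ofHom (LinearMap.toSpanSingleton R _ y))
      (by ext; simp [hy])
    exact ModuleCat.exists_eq_of_cover_lift hπ h₁
  · intro h A x₂ hx₂ y₁ hy₁
    refine ModuleCat.exists_cover_lift _ _ fun a => h (x₂ a) ?_ (y₁ a) ?_
    · simpa using congr($hx₂ a)
    · simpa using congr($hy₁ a)

theorem Ch.epi_homologyMap_iff {X Y : Ch R} (f : X ⟶ Y) (n : ℕ) :
    Epi (HomologicalComplex.homologyMap f n) ↔
      ∀ y : Y.X n, Y.d n (n - 1) y = 0 → ∃ x : X.X n, X.d n (n - 1) x = 0 ∧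
        ∃ y' : Y.X (n + 1), y = f.f n x + Y.d (n + 1) n y' := by
  rw [HomologicalComplex.epi_homologyMap_iff_up_to_refinements f (n + 1) n (n - 1)
    (ChainComplex.prev_nat n) (ChainComplex.next_nat n)]
  constructor
  · intro h y hy
    obtain ⟨A', π, hπ, x, hx, y₁, h₁⟩ := h (ModuleCat.ofHom (LinearMap.toSpanSingleton R _ y))
      (by ext; simp [hy])
    rw [ModuleCat.epi_iff_surjective] at hπ
    obtain ⟨a, ha⟩ := hπ (1 : R)
    refine ⟨x a, by simpa using congr($hx a), y₁ a, ?_⟩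
    simpa [ha] using congr($h₁ a)
  · intro h A y hy
    choose g hg g' hg' using fun a => h (y a) (by simpa using congr($hy a))
    refine ⟨ModuleCat.of R (A →₀ R), ModuleCat.ofHom (Finsupp.linearCombination R id), ?_,
      ModuleCat.ofHom (Finsupp.linearCombination R g), ?_,
      ModuleCat.ofHom (Finsupp.linearCombination R g'), ?_⟩
    · rw [ModuleCat.epi_iff_surjective]
      exact fun a => ⟨Finsupp.single a 1, by simp⟩
    · ext a
      simp [hg]
    · ext a
      simp [← hg']

theorem Ch.quasiIso_iff {X Y : Ch R} (f : X ⟶ Y) :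
    QuasiIso f ↔
      (∀ n, ∀ x : X.X n, X.d n (n - 1) x = 0 → ∀ y : Y.X (n + 1), f.f n x = Y.d (n + 1) n y →
        ∃ x', x = X.d (n + 1) n x') ∧
      ∀ n, ∀ y : Y.X n, Y.d n (n - 1) y = 0 → ∃ x : X.X n, X.d n (n - 1) x = 0 ∧
        ∃ y' : Y.X (n + 1), y = f.f n x + Y.d (n + 1) n y' := by
  simp_rw [← Ch.mono_homologyMap_iff, ← Ch.epi_homologyMap_iff, _root_.quasiIso_iff,
    quasiIsoAt_iff_isIso_homologyMap, ← forall_and]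
  exact forall_congr' fun n => ⟨fun h => ⟨inferInstance, inferInstance⟩,
    fun ⟨_, _⟩ => isIso_of_mono_of_epi _⟩

theorem Ch.acyclic_iff (X : Ch R) :
    X.Acyclic ↔ ∀ n, ∀ x : X.X n, X.d n (n - 1) x = 0 → ∃ y, X.d (n + 1) n y = x := by
  refine forall_congr' fun n => ?_
  rw [X.exactAt_iff' (n + 1) n (n - 1) (ChainComplex.prev_nat n) (ChainComplex.next_nat n),
    ShortComplex.moduleCat_exact_iff]
  rfl

theorem Ch.shortExact_iff (S : ShortComplex (Ch R)) :
    S.ShortExact ↔ ∀ n, Function.Injective (S.f.f n) ∧ Function.Surjective (S.g.f n) ∧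
      ∀ y, S.g.f n y = 0 → ∃ x, S.f.f n x = y := by
  rw [HomologicalComplex.shortExact_iff_degreewise_shortExact]
  refine forall_congr' fun n => ?_
  constructor
  · intro h
    exact ⟨h.moduleCat_injective_f, h.moduleCat_surjective_g,
      (ShortComplex.moduleCat_exact_iff _).1 h.exact⟩
  · rintro ⟨h₁, h₂, h₃⟩
    exact
      { exact := (ShortComplex.moduleCat_exact_iff _).2 h₃
        mono_f := (ModuleCat.mono_iff_injective _).2 h₁
        epi_g := (ModuleCat.epi_iff_surjective _).2 h₂ }

theorem Ch.quasiIso_of_acyclic {X Y : Ch R} (hX : X.Acyclic) (hY : Y.Acyclic) (f : X ⟶ Y) :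
    QuasiIso f := by
  rw [Ch.acyclic_iff] at hX hY
  rw [Ch.quasiIso_iff]
  refine ⟨fun n x hx _ _ => ?_, fun n y hy => ?_⟩
  · obtain ⟨x', h⟩ := hX n x hx
    exact ⟨x', h.symm⟩
  · obtain ⟨y', h⟩ := hY n y hy
    exact ⟨0, by simp, y', by simp [h]⟩

theorem Ch.acyclic_of_isZero {X : Ch R} (hX : IsZero X) : X.Acyclic := by
  rw [Ch.acyclic_iff]
  intro n x _
  have h : 𝟙 X = 0 := (IsZero.iff_id_eq_zero X).1 hX
  have := congr(HomologicalComplex.Hom.f $h n x)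
  exact ⟨0, by simpa using this.symm⟩

end Elementwise

/-! ### Closure properties of cellular classes -/

section Cellular

variable {R : Type u} [CommRing R] {A : Ch R}

theorem IsCellular.trans {B X : Ch R} (hB : IsCellular A B) (hX : IsCellular B X) :
    IsCellular A X := by
  induction hX with
  | self => exact hB
  | sum X _ ih => exact .sum X ih
  | of_source f hf _ ih => exact .of_source f hf ih
  | of_target f hf _ ih => exact .of_target f hf ih
  | quotient S hS _ _ ih₁ ih₂ => exact .quotient S hS ih₁ ih₂

theorem IsCellular.of_iso {X Y : Ch R} (hX : IsCellular A X) (e : X ≅ Y) : IsCellular A Y :=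
  .of_source e.hom inferInstance hX

theorem cellularClass_eq {X Y : Ch R} (h₁ : IsCellular X Y) (h₂ : IsCellular Y X) :
    cellularClass X = cellularClass Y :=
  Set.Subset.antisymm (fun _ h => h₂.trans h) (fun _ h => h₁.trans h)

theorem IsCellular.of_cellularClass_eq {X Y : Ch R} (h : cellularClass X = cellularClass Y) :
    IsCellular X Y := by
  have : Y ∈ cellularClass Y := IsCellular.self
  rwa [← h] at this

/-- The empty direct sum is a zero complex, and it is weakly equivalent to any acyclic one. -/
theorem IsCellular.of_acyclic {X : Ch R} (hX : X.Acyclic) : IsCellular A X := by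
  have h : IsCellular A (∐ (PEmpty.elim : PEmpty.{u + 1} → Ch R)) := .sum _ fun a => a.elim
  refine .of_source (0 : _ ⟶ X) (Ch.quasiIso_of_acyclic (Ch.acyclic_of_isZero ?_) hX _) h
  rw [IsZero.iff_id_eq_zero]
  exact Sigma.hom_ext _ _ fun a => a.elim

theorem IsCellular.sigma {ι : Type} (X : ι → Ch R) (hX : ∀ a, IsCellular A (X a)) :
    IsCellular A (∐ X) :=
  (IsCellular.sum (fun a : ULift.{u} ι => X a.down) fun a => hX a.down).of_iso
    (Sigma.whiskerEquiv Equiv.ulift fun _ => Iso.refl _)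

theorem IsCellular.biprod {X Y : Ch R} (hX : IsCellular A X) (hY : IsCellular A Y) :
    IsCellular A (X ⊞ Y) := by
  let F : Bool → Ch R := fun b => bif b then X else Y
  have h : IsCellular A (∐ F) := .sigma _ fun b => by cases b <;> assumption
  refine h.of_iso
    { hom := Sigma.desc fun b => match b with
        | true => biprod.inl
        | false => biprod.inr
      inv := biprod.desc (Sigma.ι F true) (Sigma.ι F false)
      hom_inv_id := ?_
      inv_hom_id := ?_ }
  · ext1 b
    cases b <;> simp
  · apply biprod.hom_ext' <;> simp <;> rfl

/-- The shift `∐ X → ∐ X` of an infinite sum of copies of `X`, on the summand cut out by the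
idempotent `e`. -/
noncomputable def sigmaShift {C : Type*} [Category C] [Preadditive C] {X : C}
    [HasCoproduct fun _ : ULift.{u} ℕ => X] (e : X ⟶ X) :
    (∐ fun _ : ULift.{u} ℕ => X) ⟶ ∐ fun _ : ULift.{u} ℕ => X :=
  Sigma.desc fun n => e ≫ Sigma.ι (fun _ : ULift.{u} ℕ => X) ⟨n.down + 1⟩ +
    (𝟙 X - e) ≫ Sigma.ι (fun _ : ULift.{u} ℕ => X) n

/-- The left inverse of `sigmaShift e` for an idempotent `e`. -/
noncomputable def sigmaUnshift {C : Type*} [Category C] [Preadditive C] {X : C}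
    [HasCoproduct fun _ : ULift.{u} ℕ => X] (e : X ⟶ X) :
    (∐ fun _ : ULift.{u} ℕ => X) ⟶ ∐ fun _ : ULift.{u} ℕ => X :=
  Sigma.desc fun n => (if n.down = 0 then 0 else
      e ≫ Sigma.ι (fun _ : ULift.{u} ℕ => X) ⟨n.down - 1⟩) +
    (𝟙 X - e) ≫ Sigma.ι (fun _ : ULift.{u} ℕ => X) n

/-- Eilenberg swindle. With `e = p ≫ i`, shift the image of `e` in a countable sum of copies of `X`
by one place and fix the complement. This is a split monomorphism, and its cokernel is the copy of
`Y` in place zero. -/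
theorem IsCellular.of_retract {X Y : Ch R} (hX : IsCellular A X) (i : Y ⟶ X) (p : X ⟶ Y)
    (hip : i ≫ p = 𝟙 Y) : IsCellular A Y := by
  let F : ULift.{u} ℕ → Ch R := fun _ => X
  let g : ∐ F ⟶ Y := Sigma.desc fun n => if n.down = 0 then p else 0
  let S : ShortComplex (Ch R) := ShortComplex.mk (sigmaShift.{u} (p ≫ i)) g (by
    refine Sigma.hom_ext _ _ fun n => ?_
    by_cases hn : n.down = 0 <;> simp [sigmaShift, g, F, hn, hip])
  have hS : S.Splitting :=
    { r := sigmaUnshift.{u} (p ≫ i)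
      s := i ≫ Sigma.ι F ⟨0⟩
      f_r := by
        refine Sigma.hom_ext _ _ fun n => ?_
        obtain ⟨n⟩ := n
        cases n <;> simp [S, sigmaShift, sigmaUnshift, reassoc_of% hip]
      s_g := by simp [S, g, hip]
      id := by
        refine Sigma.hom_ext _ _ fun n => ?_
        obtain ⟨n⟩ := n
        cases n <;> simp [S, F, g, sigmaShift, sigmaUnshift, reassoc_of% hip]
 }
  exact .quotient S hS.shortExact (.sum F fun _ => hX) (.sum F fun _ => hX)

end Cellular

/-! ### Complexes of rank at most one in each degree, and their extensions -/

section Line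

open Classical

variable {R : Type u} [CommRing R]

/-- Extension by zero of an element of `R ^ p`, where `p` is a proposition. -/
noncomputable def propVal (R : Type u) [CommRing R] (p : Prop) : (PLift p → R) →ₗ[R] R where
  toFun f := if h : p then f ⟨h⟩ else 0
  map_add' f g := by split_ifs <;> simp
  map_smul' a f := by split_ifs <;> simp

/-- The element of `R ^ p` with a given value. -/
def propConst (R : Type u) [CommRing R] (p : Prop) : R →ₗ[R] (PLift p → R) where
  toFun a := fun _ => a
  map_add' _ _ := rfl
  map_smul' _ _ := rfl

theorem propVal_const (p : Prop) (a : R) : propVal R p (propConst R p a) = if p then a else 0 := by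
  simp [propVal, propConst]

theorem propVal_of_not {p : Prop} (h : ¬ p) (f : PLift p → R) : propVal R p f = 0 := by
  simp [propVal, h]

theorem propVal_injective (p : Prop) : Function.Injective (propVal R p) := by
  intro f g h
  ext ⟨hp⟩
  simpa [propVal, hp] using h

/-- The differential of `line p c` from degree `n + 1` to degree `n`. -/
noncomputable def lineDiff (p : ℕ → Prop) (c : ℕ → R) (n : ℕ) :
    (PLift (p (n + 1)) → R) →ₗ[R] (PLift (p n) → R) :=
  (propConst R (p n)).comp (c n • propVal R (p (n + 1)))

theorem val_lineDiff (p : ℕ → Prop) (c : ℕ → R) (n : ℕ) (x : PLift (p (n + 1)) → R) :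
    propVal R (p n) (lineDiff p c n x) = if p n then c n * propVal R (p (n + 1)) x else 0 :=
  propVal_const _ _

theorem lineDiff_comp (p : ℕ → Prop) (c : ℕ → R)
    (h : ∀ n, p n → p (n + 1) → p (n + 2) → c n * c (n + 1) = 0) (n : ℕ) :
    (lineDiff p c n).comp (lineDiff p c (n + 1)) = 0 := by
  refine LinearMap.ext fun x => propVal_injective _ ?_
  by_cases h₀ : p n <;> by_cases h₁ : p (n + 1) <;> by_cases h₂ : p (n + 2) <;>
    simp [val_lineDiff, propVal_of_not, *, ← mul_assoc]

/-- The complex with `R` in the degrees satisfying `p`, zero elsewhere, and differential from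
degree `n + 1` to degree `n` given by multiplication by `c n`. -/
noncomputable def line (p : ℕ → Prop) (c : ℕ → R)
    (h : ∀ n, p n → p (n + 1) → p (n + 2) → c n * c (n + 1) = 0) : Ch R :=
  ChainComplex.of (fun n => ModuleCat.of R (PLift (p n) → R))
    (fun n => ModuleCat.ofHom (lineDiff p c n))
    (fun n => by
      rw [← ModuleCat.ofHom_comp, lineDiff_comp p c h n]
      rfl)

namespace line

variable {p : ℕ → Prop} {c : ℕ → R} {h : ∀ n, p n → p (n + 1) → p (n + 2) → c n * c (n + 1) = 0}

/-- The coordinate in degree `n`, zero if `n` does not satisfy `p`. -/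
noncomputable def coeff (n : ℕ) : (line p c h).X n →ₗ[R] R := propVal R (p n)

/-- The element of degree `n` with a given coordinate. -/
noncomputable def mk (n : ℕ) : R →ₗ[R] (line p c h).X n := propConst R (p n)

theorem coeff_mk (n : ℕ) (a : R) :
    coeff n (mk n a : (line p c h).X n) = if p n then a else 0 :=
  propVal_const _ _

theorem coeff_of_not {n : ℕ} (hn : ¬ p n) (x : (line p c h).X n) : coeff n x = 0 :=
  propVal_of_not hn x

theorem coeff_injective (n : ℕ) :
    Function.Injective (coeff n : (line p c h).X n →ₗ[R] R) :=
  propVal_injective _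

theorem coeff_d (n : ℕ) (x : (line p c h).X (n + 1)) :
    coeff n ((line p c h).d (n + 1) n x) = if p n then c n * coeff (n + 1) x else 0 := by
  have key : (line p c h).d (n + 1) n = ModuleCat.ofHom (lineDiff p c n) :=
    ChainComplex.of_d (fun n => ModuleCat.of R (PLift (p n) → R))
      (fun n => ModuleCat.ofHom (lineDiff p c n)) n
  rw [key]
  exact propVal_const _ _

theorem mk_coeff (n : ℕ) (x : (line p c h).X n) : mk n (coeff n x) = x := by
  apply coeff_injective
  by_cases hn : p n <;> simp [coeff_mk, coeff_of_not, hn]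

/-- The morphism to `line p c` with given coordinate functionals. -/
noncomputable def lift {X : Ch R} (φ : ∀ n, X.X n →ₗ[R] R)
    (hφ : ∀ n, p n → ∀ x, φ n (X.d (n + 1) n x) = if p (n + 1) then c n * φ (n + 1) x else 0) :
    X ⟶ line p c h where
  f n := ModuleCat.ofHom ((mk n : R →ₗ[R] (line p c h).X n).comp (φ n))
  comm' := by
    rintro _ n rfl
    refine ModuleCat.hom_ext (LinearMap.ext fun x => ?_)
    apply coeff_injective
    change coeff n ((line p c h).d (n + 1) n (mk (n + 1) (φ (n + 1) x))) =
      coeff n (mk n (φ n (X.d (n + 1) n x)) : (line p c h).X n)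
    by_cases hn : p n <;> simp [coeff_mk, coeff_d, hn, hφ]

theorem coeff_lift {X : Ch R} (φ : ∀ n, X.X n →ₗ[R] R)
    (hφ : ∀ n, p n → ∀ x, φ n (X.d (n + 1) n x) = if p (n + 1) then c n * φ (n + 1) x else 0)
    (n : ℕ) (x : X.X n) : coeff n ((lift φ hφ : X ⟶ line p c h).f n x) = if p n then φ n x else 0 :=
  coeff_mk _ _

/-- The morphism from `line p c` with given images of the basis elements. -/
noncomputable def desc {X : Ch R} (y : ∀ n, X.X n)
    (hy : ∀ n, p (n + 1) → X.d (n + 1) n (y (n + 1)) = if p n then c n • y n else 0) :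
    line p c h ⟶ X where
  f n := ModuleCat.ofHom ((LinearMap.toSpanSingleton R (X.X n) (y n)).comp
    (coeff n : (line p c h).X n →ₗ[R] R))
  comm' := by
    rintro _ n rfl
    refine ModuleCat.hom_ext (LinearMap.ext fun x => ?_)
    change X.d (n + 1) n ((coeff (n + 1) x : R) • y (n + 1)) =
      (coeff n ((line p c h).d (n + 1) n x) : R) • y n
    by_cases hn : p (n + 1) <;> by_cases hn' : p n <;>
      simp [coeff_d, hn, hn', hy, coeff_of_not, mul_smul, smul_comm (c n)]

theorem desc_apply {X : Ch R} (y : ∀ n, X.X n)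
    (hy : ∀ n, p (n + 1) → X.d (n + 1) n (y (n + 1)) = if p n then c n • y n else 0)
    (n : ℕ) (x : (line p c h).X n) : (desc y hy).f n x = coeff n x • y n := rfl

theorem isIso_desc_lift {X : Ch R} (y : ∀ n, X.X n)
    (hy : ∀ n, p (n + 1) → X.d (n + 1) n (y (n + 1)) = if p n then c n • y n else 0)
    (φ : ∀ n, X.X n →ₗ[R] R)
    (hφ : ∀ n, p n → ∀ x, φ n (X.d (n + 1) n x) = if p (n + 1) then c n * φ (n + 1) x else 0)
    (hu : ∀ n, p n → IsUnit (φ n (y n))) :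
    IsIso ((desc y hy : line p c h ⟶ X) ≫ (lift φ hφ : X ⟶ line p c h)) := by
  have key : ∀ n (x : (line p c h).X n),
      coeff n (((desc y hy : line p c h ⟶ X) ≫ (lift φ hφ : X ⟶ line p c h)).f n x) =
        coeff n x * φ n (y n) := by
    intro n x
    by_cases hn : p n <;> simp [desc_apply, coeff_lift, hn, coeff_of_not]
  have : ∀ n, IsIso (((desc y hy : line p c h ⟶ X) ≫ (lift φ hφ : X ⟶ line p c h)).f n) := by
    intro n
    rw [ConcreteCategory.isIso_iff_bijective]
    constructor
    · intro a b hab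
      apply coeff_injective
      by_cases hn : p n
      · have := congr(coeff n $hab)
        rw [key, key] at this
        exact (hu n hn).mul_right_cancel this
      · simp [coeff_of_not, hn]
    · intro b
      by_cases hn : p n
      · obtain ⟨v, hv⟩ := hu n hn
        refine ⟨mk n (coeff n b * ↑v⁻¹), coeff_injective n ?_⟩
        rw [key, coeff_mk, if_pos hn, ← hv, mul_assoc, Units.inv_mul, mul_one]
      · refine ⟨0, coeff_injective n ?_⟩
        rw [coeff_of_not hn, coeff_of_not hn]
  exact HomologicalComplex.Hom.isIso_of_components _

theorem ext_hom {X : Ch R} {f g : X ⟶ line p c h}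
    (H : ∀ n x, coeff n (f.f n x) = coeff n (g.f n x)) : f = g := by
  ext n : 1
  refine ModuleCat.hom_ext (LinearMap.ext fun x => ?_)
  exact coeff_injective n (H n x)

end line

/-- The differential of `twoLine p q c c' s` from degree `n + 1` to degree `n`. -/
noncomputable def twoLineDiff (p q : ℕ → Prop) (c c' s : ℕ → R) (n : ℕ) :
    (PLift (p (n + 1)) → R) × (PLift (q (n + 1)) → R) →ₗ[R]
      (PLift (p n) → R) × (PLift (q n) → R) :=
  ((propConst R (p n)).comp ((c n • propVal R (p (n + 1))).coprod
    (s n • propVal R (q (n + 1))))).prod ((lineDiff q c' n).comp (LinearMap.snd R _ _))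

theorem val_fst_twoLineDiff (p q : ℕ → Prop) (c c' s : ℕ → R) (n : ℕ)
    (x : (PLift (p (n + 1)) → R) × (PLift (q (n + 1)) → R)) :
    propVal R (p n) (twoLineDiff p q c c' s n x).1 =
      if p n then c n * propVal R (p (n + 1)) x.1 + s n * propVal R (q (n + 1)) x.2 else 0 :=
  propVal_const _ _

theorem val_snd_twoLineDiff (p q : ℕ → Prop) (c c' s : ℕ → R) (n : ℕ)
    (x : (PLift (p (n + 1)) → R) × (PLift (q (n + 1)) → R)) :
    propVal R (q n) (twoLineDiff p q c c' s n x).2 =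
      if q n then c' n * propVal R (q (n + 1)) x.2 else 0 :=
  propVal_const _ _

/-- The differential is a triangular matrix. The off-diagonal entry of its square is `c s + s c'`,
where each term is present only if the intermediate degree is occupied; `hs` says that this entry
vanishes. -/
theorem twoLineDiff_comp (p q : ℕ → Prop) (c c' s : ℕ → R)
    (h : ∀ n, p n → p (n + 1) → p (n + 2) → c n * c (n + 1) = 0)
    (h' : ∀ n, q n → q (n + 1) → q (n + 2) → c' n * c' (n + 1) = 0)
    (hs : ∀ n, p n → q (n + 2) →
      (if p (n + 1) then c n * s (n + 1) else 0) + (if q (n + 1) then s n * c' (n + 1) else 0) = 0)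
    (n : ℕ) : (twoLineDiff p q c c' s n).comp (twoLineDiff p q c c' s (n + 1)) = 0 := by
  refine LinearMap.ext fun x => Prod.ext (propVal_injective _ ?_)
    (LinearMap.congr_fun (lineDiff_comp q c' h' n) x.2)
  by_cases h₀ : p n
  · have e₁ : (if p (n + 1) then c n * c (n + 1) * propVal R (p (n + 2)) x.1 else 0) = 0 := by
      by_cases h₂ : p (n + 2)
      · by_cases h₁ : p (n + 1) <;> simp [h₁, h n h₀, h₂]
      · simp [propVal_of_not h₂]
    have e₂ : ((if p (n + 1) then c n * s (n + 1) else 0) +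
        (if q (n + 1) then s n * c' (n + 1) else 0)) * propVal R (q (n + 2)) x.2 = 0 := by
      by_cases h₂ : q (n + 2)
      · rw [hs n h₀ h₂, zero_mul]
      · rw [propVal_of_not h₂, mul_zero]
    rw [LinearMap.comp_apply, val_fst_twoLineDiff, val_fst_twoLineDiff, val_snd_twoLineDiff,
      if_pos h₀, LinearMap.zero_apply, Prod.fst_zero, map_zero]
    trans (if p (n + 1) then c n * c (n + 1) * propVal R (p (n + 2)) x.1 else 0) +
      ((if p (n + 1) then c n * s (n + 1) else 0) +
        (if q (n + 1) then s n * c' (n + 1) else 0)) * propVal R (q (n + 2)) x.2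
    · split_ifs <;> ring
    · rw [e₁, e₂, add_zero]
  · rw [propVal_of_not h₀, propVal_of_not h₀]

/-- The extension of `line q c'` by `line p c` with connecting coefficients `s`. -/
noncomputable def twoLine (p q : ℕ → Prop) (c c' s : ℕ → R)
    (h : ∀ n, p n → p (n + 1) → p (n + 2) → c n * c (n + 1) = 0)
    (h' : ∀ n, q n → q (n + 1) → q (n + 2) → c' n * c' (n + 1) = 0)
    (hs : ∀ n, p n → q (n + 2) →
      (if p (n + 1) then c n * s (n + 1) else 0) + (if q (n + 1) then s n * c' (n + 1) else 0) = 0) :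
    Ch R :=
  ChainComplex.of (fun n => ModuleCat.of R ((PLift (p n) → R) × (PLift (q n) → R)))
    (fun n => ModuleCat.ofHom (twoLineDiff p q c c' s n))
    (fun n => by
      rw [← ModuleCat.ofHom_comp, twoLineDiff_comp p q c c' s h h' hs n]
      rfl)

namespace twoLine

variable {p q : ℕ → Prop} {c c' s : ℕ → R}
  {h : ∀ n, p n → p (n + 1) → p (n + 2) → c n * c (n + 1) = 0}
  {h' : ∀ n, q n → q (n + 1) → q (n + 2) → c' n * c' (n + 1) = 0}
  {hs : ∀ n, p n → q (n + 2) →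
    (if p (n + 1) then c n * s (n + 1) else 0) + (if q (n + 1) then s n * c' (n + 1) else 0) = 0}

/-- The coordinate in the subcomplex `line p c`. -/
noncomputable def fst (n : ℕ) : (twoLine p q c c' s h h' hs).X n →ₗ[R] R :=
  (propVal R (p n)).comp (LinearMap.fst R (PLift (p n) → R) (PLift (q n) → R))

/-- The coordinate in the quotient `line q c'`. -/
noncomputable def snd (n : ℕ) : (twoLine p q c c' s h h' hs).X n →ₗ[R] R :=
  (propVal R (q n)).comp (LinearMap.snd R (PLift (p n) → R) (PLift (q n) → R))

/-- The element of degree `n` with given coordinates. -/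
noncomputable def mk (n : ℕ) (a b : R) : (twoLine p q c c' s h h' hs).X n :=
  (propConst R (p n) a, propConst R (q n) b)

theorem fst_mk (n : ℕ) (a b : R) :
    fst n (mk n a b : (twoLine p q c c' s h h' hs).X n) = if p n then a else 0 :=
  propVal_const _ _

theorem snd_mk (n : ℕ) (a b : R) :
    snd n (mk n a b : (twoLine p q c c' s h h' hs).X n) = if q n then b else 0 :=
  propVal_const _ _

theorem fst_of_not {n : ℕ} (hn : ¬ p n) (x : (twoLine p q c c' s h h' hs).X n) : fst n x = 0 :=
  propVal_of_not hn _

theorem snd_of_not {n : ℕ} (hn : ¬ q n) (x : (twoLine p q c c' s h h' hs).X n) : snd n x = 0 :=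
  propVal_of_not hn _

theorem ext {n : ℕ} {x y : (twoLine p q c c' s h h' hs).X n} (h₁ : fst n x = fst n y)
    (h₂ : snd n x = snd n y) : x = y :=
  Prod.ext (propVal_injective _ h₁) (propVal_injective _ h₂)

theorem d_eq (n : ℕ) : (twoLine p q c c' s h h' hs).d (n + 1) n =
    ModuleCat.ofHom (twoLineDiff p q c c' s n) :=
  ChainComplex.of_d (fun n => ModuleCat.of R ((PLift (p n) → R) × (PLift (q n) → R)))
    (fun n => ModuleCat.ofHom (twoLineDiff p q c c' s n)) n

theorem fst_d (n : ℕ) (x : (twoLine p q c c' s h h' hs).X (n + 1)) :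
    fst n ((twoLine p q c c' s h h' hs).d (n + 1) n x) =
      if p n then c n * fst (n + 1) x + s n * snd (n + 1) x else 0 := by
  rw [d_eq]
  exact propVal_const _ _

theorem snd_d (n : ℕ) (x : (twoLine p q c c' s h h' hs).X (n + 1)) :
    snd n ((twoLine p q c c' s h h' hs).d (n + 1) n x) =
      if q n then c' n * snd (n + 1) x else 0 := by
  rw [d_eq]
  exact propVal_const _ _

/-- The inclusion of the subcomplex. -/
noncomputable def inl : line p c h ⟶ twoLine p q c c' s h h' hs :=
  line.desc (fun n => mk n 1 0) (fun n hn => by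
    apply ext <;> by_cases hn' : p n <;> simp [fst_d, snd_d, fst_mk, snd_mk, hn, hn'])

/-- The projection to the quotient complex. -/
noncomputable def proj : twoLine p q c c' s h h' hs ⟶ line q c' h' :=
  line.lift snd (fun n hn x => by
    by_cases hn' : q (n + 1) <;> simp [snd_d, hn, hn', snd_of_not])

theorem fst_inl (n : ℕ) (x : (line p c h).X n) :
    fst n ((inl : _ ⟶ twoLine p q c c' s h h' hs).f n x) = line.coeff n x := by
  by_cases hn : p n <;> simp [inl, line.desc_apply, fst_mk, hn, line.coeff_of_not]

theorem snd_inl (n : ℕ) (x : (line p c h).X n) :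
    snd n ((inl : _ ⟶ twoLine p q c c' s h h' hs).f n x) = 0 := by
  simp [inl, line.desc_apply, snd_mk]

theorem coeff_proj (n : ℕ) (x : (twoLine p q c c' s h h' hs).X n) :
    line.coeff n ((proj : twoLine p q c c' s h h' hs ⟶ _).f n x) = snd n x := by
  by_cases hn : q n <;> simp [proj, line.coeff_lift, hn, snd_of_not]

theorem inl_injective (n : ℕ) :
    Function.Injective ((inl : line p c h ⟶ twoLine p q c c' s h h' hs).f n) := by
  intro x y hxy
  apply line.coeff_injective
  have := congr(fst n $hxy)
  rwa [fst_inl, fst_inl] at this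

theorem proj_surjective (n : ℕ) :
    Function.Surjective ((proj : twoLine p q c c' s h h' hs ⟶ line q c' h').f n) := by
  intro y
  refine ⟨mk n 0 (line.coeff n y), line.coeff_injective n ?_⟩
  rw [coeff_proj, snd_mk]
  by_cases hn : q n <;> simp [hn, line.coeff_of_not]

theorem exists_inl_eq (n : ℕ) (y : (twoLine p q c c' s h h' hs).X n)
    (hy : (proj : _ ⟶ line q c' h').f n y = 0) :
    ∃ x, (inl : line p c h ⟶ _).f n x = y := by
  have := congr(line.coeff n $hy)
  rw [coeff_proj, map_zero] at this
  refine ⟨line.mk n (fst n y), ext ?_ ?_⟩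
  · rw [fst_inl, line.coeff_mk]
    by_cases hn : p n <;> simp [hn, fst_of_not]
  · rw [snd_inl, this]

theorem isCellular_quotient {A : Ch R} (h₁ : IsCellular A (line p c h))
    (h₂ : IsCellular A (twoLine p q c c' s h h' hs)) : IsCellular A (line q c' h') := by
  have zero : (inl : _ ⟶ twoLine p q c c' s h h' hs) ≫ proj = 0 :=
    line.ext_hom fun n x => by
      simpa [snd_inl] using coeff_proj n ((inl : _ ⟶ twoLine p q c c' s h h' hs).f n x)
  exact .quotient (ShortComplex.mk _ _ zero) ((Ch.shortExact_iff _).2 fun n =>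
    ⟨inl_injective n, proj_surjective n, exists_inl_eq n⟩) h₁ h₂

end twoLine

end Line

/-! ### Building larger complexes `Σ^i E_j` from smaller ones -/

section Bar

open Classical

variable {R : Type u} [CommRing R]

theorem Ch.d_zero_apply (X : Ch R) (x : X.X 0) : X.d 0 (0 - 1) x = 0 := by
  rw [X.shape 0 (0 - 1) (by simp)]
  rfl

theorem line.cycle {p : ℕ → Prop} {c : ℕ → R}
    {h : ∀ n, p n → p (n + 1) → p (n + 2) → c n * c (n + 1) = 0} {n : ℕ} {x : (line p c h).X n}
    (hx : (line p c h).d n (n - 1) x = 0) {m : ℕ} (hm : m + 1 = n) (hp : p m) :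
    c m * line.coeff n x = 0 := by
  subst hm
  have := congr(line.coeff m $(show (line p c h).d (m + 1) m x = 0 from hx))
  rwa [line.coeff_d, if_pos hp, map_zero] at this

theorem twoLine.cycle_fst {p q : ℕ → Prop} {c c' s : ℕ → R}
    {h : ∀ n, p n → p (n + 1) → p (n + 2) → c n * c (n + 1) = 0}
    {h' : ∀ n, q n → q (n + 1) → q (n + 2) → c' n * c' (n + 1) = 0}
    {hs : ∀ n, p n → q (n + 2) →
      (if p (n + 1) then c n * s (n + 1) else 0) + (if q (n + 1) then s n * c' (n + 1) else 0) = 0}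
    {n : ℕ} {x : (twoLine p q c c' s h h' hs).X n}
    (hx : (twoLine p q c c' s h h' hs).d n (n - 1) x = 0) {m : ℕ} (hm : m + 1 = n) (hp : p m) :
    c m * twoLine.fst n x + s m * twoLine.snd n x = 0 := by
  subst hm
  have := congr(twoLine.fst m
    $(show (twoLine p q c c' s h h' hs).d (m + 1) m x = 0 from hx))
  rwa [twoLine.fst_d, if_pos hp, map_zero] at this

theorem twoLine.cycle_snd {p q : ℕ → Prop} {c c' s : ℕ → R}
    {h : ∀ n, p n → p (n + 1) → p (n + 2) → c n * c (n + 1) = 0}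
    {h' : ∀ n, q n → q (n + 1) → q (n + 2) → c' n * c' (n + 1) = 0}
    {hs : ∀ n, p n → q (n + 2) →
      (if p (n + 1) then c n * s (n + 1) else 0) + (if q (n + 1) then s n * c' (n + 1) else 0) = 0}
    {n : ℕ} {x : (twoLine p q c c' s h h' hs).X n}
    (hx : (twoLine p q c c' s h h' hs).d n (n - 1) x = 0) {m : ℕ} (hm : m + 1 = n) (hq : q m) :
    c' m * twoLine.snd n x = 0 := by
  subst hm
  have := congr(twoLine.snd m
    $(show (twoLine p q c c' s h h' hs).d (m + 1) m x = 0 from hx))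
  rwa [twoLine.snd_d, if_pos hq, map_zero] at this

/-- The complex `Σ^i E_j` without signs. -/
noncomputable abbrev bar (r : R) (hr : r * r = 0) (i j : ℕ) : Ch R :=
  line (fun n => i ≤ n ∧ n ≤ i + j) (fun _ => r) (fun _ _ _ _ => hr)

theorem sigmaE_eq_line (r : R) (hr : r * r = 0) (i j : ℕ) :
    sigmaE r hr i j = line (fun n => i ≤ n ∧ n ≤ i + j) (fun _ => (-1) ^ i * r)
      (fun _ _ _ _ => by rw [mul_mul_mul_comm, hr, mul_zero]) := by
  have key : ∀ n, sigmaEDiff r i j n =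
      lineDiff (fun n => i ≤ n ∧ n ≤ i + j) (fun _ => (-1) ^ i * r) n := by
    intro n
    refine LinearMap.ext fun f => funext fun a => ?_
    simp [sigmaEDiff, lineDiff, propConst, propVal]
  simp only [sigmaE, line, key]

theorem nonempty_sigmaE_iso_bar (r : R) (hr : r * r = 0) (i j : ℕ) :
    Nonempty (sigmaE r hr i j ≅ bar r hr i j) := by
  rw [sigmaE_eq_line]
  set ε : R := (-1) ^ i with hε
  have hεε : ε * ε = 1 := by rw [hε, ← mul_pow, neg_one_mul, neg_neg, one_pow]
  have hu : ∀ n, ε ^ n * ε ^ n = 1 := fun n => by rw [← mul_pow, hεε, one_pow]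
  let f : line (fun n => i ≤ n ∧ n ≤ i + j) (fun _ => ε * r)
      (fun _ _ _ _ => by rw [mul_mul_mul_comm, hr, mul_zero]) ⟶ bar r hr i j :=
    -- Rescaling degree `n` by `ε ^ n` absorbs one factor `ε` in each differential.
    line.lift (fun n => ε ^ n • line.coeff n) (fun n hn x => by
      by_cases hn' : i ≤ n + 1 ∧ n + 1 ≤ i + j
      · rw [if_pos hn', LinearMap.smul_apply, LinearMap.smul_apply, line.coeff_d, if_pos hn,
          smul_eq_mul, smul_eq_mul]
        ring
      · rw [if_neg hn', LinearMap.smul_apply, line.coeff_d, line.coeff_of_not hn']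
        simp)
  have hf : ∀ n x, line.coeff n (f.f n x) = ε ^ n * line.coeff n x := by
    intro n x
    rw [line.coeff_lift]
    split_ifs with hn
    · rfl
    · rw [line.coeff_of_not hn, mul_zero]
  have : ∀ n, IsIso (f.f n) := by
    intro n
    rw [ConcreteCategory.isIso_iff_bijective]
    constructor
    · intro a b hab
      apply line.coeff_injective
      have := congr(line.coeff n $hab)
      rw [hf, hf] at this
      exact (IsUnit.of_mul_eq_one _ (hu n)).mul_left_cancel this
    · intro b
      refine ⟨line.mk n (ε ^ n * line.coeff n b), line.coeff_injective n ?_⟩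
      rw [hf, line.coeff_mk]
      split_ifs with hn
      · rw [← mul_assoc, hu, one_mul]
      · rw [line.coeff_of_not hn, mul_zero]
  have := HomologicalComplex.Hom.isIso_of_components f
  exact ⟨asIso f⟩

variable {A : Ch R} {r : R} {hr : r * r = 0}

/-- The middle term is the cone of the identity; the alternating connecting sign makes its
differential square to zero. -/
theorem IsCellular.bar_shift {i j : ℕ} (hA : IsCellular A (bar r hr i j)) :
    IsCellular A (bar r hr (i + 1) j) := by
  let T : Ch R := twoLine (fun n => i ≤ n ∧ n ≤ i + j) (fun n => i + 1 ≤ n ∧ n ≤ i + 1 + j)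
    (fun _ => r) (fun _ => r) (fun n => (-1) ^ n) (fun _ _ _ _ => hr) (fun _ _ _ _ => hr)
    (fun n hp hq => by
      rw [if_pos (by omega), if_pos (by omega)]
      ring)
  have hT : T.Acyclic := by
    rw [Ch.acyclic_iff]
    intro n x hx
    -- The standard contraction of the cone: move the first coordinate into the second, one degree
    -- up.
    refine ⟨twoLine.mk (n + 1) 0 ((-1) ^ n * twoLine.fst n x), twoLine.ext ?_ ?_⟩
    · rw [twoLine.fst_d, twoLine.fst_mk, twoLine.snd_mk]
      by_cases hn : i ≤ n ∧ n ≤ i + j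
      · rw [if_pos hn, ite_self, mul_zero, zero_add, if_pos (by omega), ← mul_assoc, ← mul_pow]
        simp
      · rw [if_neg hn, twoLine.fst_of_not hn]
    · rw [twoLine.snd_d, twoLine.snd_mk]
      by_cases hn : i + 1 ≤ n ∧ n ≤ i + 1 + j
      · rw [if_pos hn]
        obtain ⟨m, rfl⟩ : ∃ m, n = m + 1 := ⟨n - 1, by omega⟩
        have := twoLine.cycle_fst hx rfl (by omega)
        have hsq : ((-1 : R) ^ m) * (-1) ^ m = 1 := by rw [← mul_pow]; simp
        by_cases hn' : m + 1 = i + 1 + j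
        · rw [twoLine.fst_of_not (by omega)] at this ⊢
          rw [mul_zero, ite_self, mul_zero]
          linear_combination twoLine.snd (m + 1) x * hsq - (-1) ^ m * this
        · rw [if_pos (by omega), pow_succ]
          linear_combination twoLine.snd (m + 1) x * hsq - (-1) ^ m * this
      · rw [if_neg hn, twoLine.snd_of_not hn]
  exact twoLine.isCellular_quotient hA (.of_acyclic hT)

/-- In `T` the generator of degree `i + j + 1` has boundary `r e + g`, where `e` and `g` generate
degree `i + j` of the quotient and of the subcomplex. Cancelling it against `g` leaves `Σ^i E_j`,
included by `f`. -/
theorem IsCellular.bar_succ {i j : ℕ} (h₁ : IsCellular A (bar r hr (i + j) 0))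
    (h₂ : IsCellular A (bar r hr i j)) : IsCellular A (bar r hr i (j + 1)) := by
  let T : Ch R := twoLine (fun n => i + j ≤ n ∧ n ≤ i + j + 0)
    (fun n => i ≤ n ∧ n ≤ i + (j + 1))
    (fun _ => r) (fun _ => r) (fun _ => 1) (fun _ _ _ _ => hr) (fun _ _ _ _ => hr)
    (fun n hp hq => by omega)
  let f : bar r hr i j ⟶ T := line.desc (fun n => twoLine.mk n 0 1) (fun n hn => by
    refine twoLine.ext ?_ ?_
    · rw [twoLine.fst_d, if_neg (by omega)]
      by_cases hn' : i ≤ n ∧ n ≤ i + j <;> simp [hn', twoLine.fst_mk]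
    · rw [twoLine.snd_d, twoLine.snd_mk]
      by_cases hn' : i ≤ n ∧ n ≤ i + j
      · rw [if_pos (by omega), if_pos hn', if_pos (by omega), map_smul, twoLine.snd_mk,
          if_pos (by omega), smul_eq_mul]
      · rw [if_neg (by omega), if_neg hn', map_zero])
  have hf₁ : ∀ n x, twoLine.fst n (f.f n x) = 0 := fun n x => by
    rw [line.desc_apply, map_smul, twoLine.fst_mk]
    simp
  have hf₂ : ∀ n x, twoLine.snd n (f.f n x) = line.coeff n x := fun n x => by
    rw [line.desc_apply, map_smul, twoLine.snd_mk]
    by_cases hn : i ≤ n ∧ n ≤ i + j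
    · rw [if_pos (by omega), smul_eq_mul, mul_one]
    · rw [line.coeff_of_not hn, zero_smul]
  have hf : QuasiIso f := by
    rw [Ch.quasiIso_iff]
    constructor
    · intro n x hx y hy
      refine ⟨line.mk (n + 1) (twoLine.snd (n + 1) y), line.coeff_injective n ?_⟩
      have e₁ := congr(twoLine.fst n $hy)
      have e₂ := congr(twoLine.snd n $hy)
      rw [hf₁, twoLine.fst_d] at e₁
      rw [hf₂, twoLine.snd_d] at e₂
      rw [line.coeff_d, line.coeff_mk, e₂]
      by_cases hn : i ≤ n ∧ n ≤ i + j
      · rw [if_pos (by omega), if_pos hn]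
        by_cases hn' : n = i + j
        · rw [if_pos (by omega), twoLine.fst_of_not (by omega)] at e₁
          rw [if_neg (by omega)]
          linear_combination r * (-e₁)
        · rw [if_pos (by omega)]
      · rw [← e₂, line.coeff_of_not hn, if_neg hn]
    · intro n y hy
      have hz : ∀ m, m + 1 = n → i ≤ m → m ≤ i + j → r * twoLine.snd n y = 0 :=
        fun m hm h₁ h₂ => twoLine.cycle_snd hy hm (by omega)
      -- Subtracting the boundary of `(0, fst y)` clears the first coordinate and changes the second
      -- by `r * fst y`.
      refine ⟨line.mk n (twoLine.snd n y - r * twoLine.fst n y), ?_,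
        twoLine.mk (n + 1) 0 (twoLine.fst n y), twoLine.ext ?_ ?_⟩
      · rcases n with _ | m
        · exact Ch.d_zero_apply _ _
        · apply line.coeff_injective
          rw [Nat.add_sub_cancel, line.coeff_d, map_zero, line.coeff_mk]
          by_cases hm : i ≤ m ∧ m ≤ i + j
          · rw [if_pos hm]
            split_ifs
            · linear_combination hz m rfl hm.1 hm.2 - twoLine.fst (m + 1) y * hr
            · rw [mul_zero]
          · rw [if_neg hm]
      · rw [map_add, hf₁, twoLine.fst_d, twoLine.fst_mk, twoLine.snd_mk, ite_self]
        by_cases hn : i + j ≤ n ∧ n ≤ i + j + 0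
        · rw [if_pos hn, if_pos (by omega)]
          ring
        · rw [if_neg hn, twoLine.fst_of_not hn, add_zero]
      · rw [map_add, hf₂, twoLine.snd_d, twoLine.snd_mk, line.coeff_mk]
        by_cases hn : i ≤ n ∧ n ≤ i + j
        · rw [if_pos hn, if_pos (by omega), if_pos (by omega)]
          ring
        · rw [if_neg hn]
          by_cases hn' : n = i + j + 1
          · have := twoLine.cycle_fst hy hn'.symm (by omega)
            rw [twoLine.fst_of_not (by omega)] at this ⊢
            rw [ite_self, mul_zero, ite_self]
            linear_combination this
          · rw [if_neg (by omega), twoLine.snd_of_not (by omega), add_zero]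
  exact twoLine.isCellular_quotient h₁ (.of_source f hf h₂)

/-- In `T`, the quotient generator of degree `i + 1` has boundary the bottom generator of `Σ^i E_j`,
and the one of degree `i + j + 1` has boundary `r` times its top generator. The first pair cancels,
leaving `Σ^{i+1} E_j`. As `j ≥ 1`, the two degrees differ. -/
theorem IsCellular.bar_zero_succ {i j : ℕ} (hj : 1 ≤ j) (h₁ : IsCellular A (bar r hr i j)) :
    IsCellular A (bar r hr (i + 1) 0) := by
  let L : Ch R := line (fun n => n = i + 1 ∨ n = i + j + 1) (fun _ => 0)
    (fun _ _ _ _ => by simp)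
  let T : Ch R := twoLine (fun n => i ≤ n ∧ n ≤ i + j)
    (fun n => n = i + 1 ∨ n = i + j + 1)
    (fun _ => r) (fun _ => 0) (fun n => if n = i then 1 else r)
    (fun _ _ _ _ => hr) (fun _ _ _ _ => by simp)
    (fun n hp hq => by
      have : n = i + j - 1 := by omega
      rw [if_pos (by omega), if_neg (by omega), hr, mul_zero, ite_self, add_zero])
  let f : T ⟶ bar r hr (i + 1) j := line.lift
    (fun n => if n = i + j + 1 then twoLine.snd n else twoLine.fst n) (fun n hn x => by
      by_cases hn' : n = i + j + 1
      · subst hn'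
        rw [if_pos rfl, if_neg (by omega), twoLine.snd_d, zero_mul, ite_self]
      · rw [if_neg hn', if_pos (by omega), twoLine.fst_d, if_pos (by omega), if_neg (by omega)]
        by_cases hn'' : n = i + j
        · rw [if_pos (by omega), twoLine.fst_of_not (by omega), mul_zero, zero_add]
        · rw [if_neg (by omega), twoLine.snd_of_not (by omega)]
          simp only [mul_zero, add_zero])
  have hfc : ∀ n x, line.coeff n (f.f n x) = if i + 1 ≤ n ∧ n ≤ i + 1 + j then
      (if n = i + j + 1 then twoLine.snd n x else twoLine.fst n x) else 0 := fun n x => by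
    rw [line.coeff_lift]
    split_ifs <;> rfl
  have hf : QuasiIso f := by
    rw [Ch.quasiIso_iff]
    constructor
    · intro n x hx y hy
      have e₁ := congr(line.coeff n $hy)
      rw [hfc, line.coeff_d] at e₁
      -- In degree `i` the element bounds through the cancelling generator; in the other degrees the
      -- coordinate of `y` is lifted.
      refine ⟨twoLine.mk (n + 1) (if n = i then 0 else line.coeff (n + 1) y)
        (if n = i then twoLine.fst n x else line.coeff (n + 1) y), twoLine.ext ?_ ?_⟩
      · rw [twoLine.fst_d, twoLine.fst_mk, twoLine.snd_mk]
        by_cases hn : i ≤ n ∧ n ≤ i + j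
        · rw [if_pos hn]
          by_cases hi : n = i
          · simp [hi]
          · rw [if_pos (by omega), if_neg (by omega), if_pos (by omega)] at e₁
            rw [if_neg hi, if_neg hi, if_neg hi, e₁]
            by_cases hj' : n = i + j
            · rw [if_neg (by omega), if_pos (by omega), mul_zero, zero_add]
            · rw [if_pos (by omega), if_neg (by omega), mul_zero, add_zero]
        · rw [if_neg hn, twoLine.fst_of_not hn]
      · rw [twoLine.snd_d]
        simp only [zero_mul, ite_self]
        by_cases hn : n = i + j + 1
        · rw [if_pos (by omega), if_pos hn, if_pos (by omega), line.coeff_of_not (by omega)] at e₁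
          exact e₁.trans (mul_zero r)
        · by_cases hn' : n = i + 1
          · rw [if_pos (by omega), if_neg hn, if_pos (by omega)] at e₁
            have := twoLine.cycle_fst hx hn'.symm (by omega)
            rw [if_pos rfl, e₁] at this
            linear_combination this - line.coeff (n + 1) y * hr
          · rw [twoLine.snd_of_not (by omega)]
    · intro n y hy
      have hz : ∀ m, m + 1 = n → i + 1 ≤ m → m ≤ i + 1 + j → r * line.coeff n y = 0 :=
        fun m hm h₁ h₂ => line.cycle hy hm (by omega)
      -- In degree `i + 1` the term `-r` times the cancelling generator makes the lift a cycle. The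
      -- map `f` kills it.
      refine ⟨twoLine.mk n (line.coeff n y)
        (if n = i + 1 then - (r * line.coeff n y) else line.coeff n y), ?_, 0, ?_⟩
      · rcases n with _ | m
        · exact Ch.d_zero_apply _ _
        · apply twoLine.ext
          · rw [Nat.add_sub_cancel, twoLine.fst_d, map_zero, twoLine.fst_mk, twoLine.snd_mk]
            by_cases hm : i ≤ m ∧ m ≤ i + j
            · rw [if_pos hm]
              by_cases hi : m = i
              · subst hi
                rw [if_pos (show m ≤ m + 1 ∧ m + 1 ≤ m + j by omega), if_pos rfl,
                  if_pos (show m + 1 = m + 1 ∨ m + 1 = m + j + 1 from .inl rfl), if_pos rfl]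
                ring
              · have := hz m rfl (by omega) (by omega)
                rw [if_neg hi, if_neg (show ¬ m + 1 = i + 1 by omega)]
                split_ifs <;> simp [this]
            · rw [if_neg hm]
          · rw [Nat.add_sub_cancel, twoLine.snd_d, map_zero, zero_mul, ite_self]
      · rw [map_zero, add_zero]
        apply line.coeff_injective
        rw [hfc, twoLine.fst_mk, twoLine.snd_mk]
        by_cases hn : i + 1 ≤ n ∧ n ≤ i + 1 + j
        · rw [if_pos hn]
          by_cases hn' : n = i + j + 1
          · rw [if_pos hn', if_pos (by omega), if_neg (by omega)]
          · rw [if_neg hn', if_pos (by omega)]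
        · rw [if_neg hn, line.coeff_of_not hn]
  have hL : IsCellular A L :=
    twoLine.isCellular_quotient h₁ (.of_target f hf h₁.bar_shift)
  -- `R[i+1]` is a direct summand of `L`, whose differential is zero.
  refine hL.of_retract (line.lift (fun n => line.coeff n) fun n hn x => ?_)
    (line.lift (fun n => line.coeff n) fun n hn x => ?_) (line.ext_hom fun n x => ?_)
  · rw [line.coeff_d, zero_mul, ite_self]
    split_ifs
    · rw [line.coeff_of_not (by omega), mul_zero]
    · rfl
  · beta_reduce at hn
    rw [line.coeff_d, zero_mul, ite_self, if_neg (by omega)]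
  · rw [HomologicalComplex.comp_f, ModuleCat.comp_apply, line.coeff_lift, line.coeff_lift]
    by_cases hn : i + 1 ≤ n ∧ n ≤ i + 1 + 0
    · rw [if_pos hn, if_pos (by omega)]
      rfl
    · rw [if_neg hn, line.coeff_of_not hn]

theorem IsCellular.bar_zero_of_le {i i' : ℕ} (h : i ≤ i') (hA : IsCellular A (bar r hr i 0)) :
    IsCellular A (bar r hr i' 0) := by
  induction i', h using Nat.le_induction with
  | base => exact hA
  | succ n _ ih => exact ih.bar_shift

theorem IsCellular.bar_of_zero {i : ℕ} (j : ℕ) (hA : IsCellular A (bar r hr i 0)) :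
    IsCellular A (bar r hr i j) := by
  induction j with
  | zero => exact hA
  | succ j ih => exact .bar_succ (hA.bar_zero_of_le (Nat.le_add_right _ _)) ih

/-- The complex `Σ^{i+1} E_0` is always reached, and it yields every pair with larger first entry.
With `i` fixed, raising the length `n ≥ j` by one needs `Σ^{i+n} E_0`: this is the generator itself
if `j = n = 0`, and a shift of something already reached otherwise. -/
theorem isCellular_bar_of_le {i j i' j' : ℕ} (h : toLex (i, j) ≤ toLex (i', j')) :
    IsCellular (bar r hr i j) (bar r hr i' j') := by
  have h₁ : IsCellular (bar r hr i j) (bar r hr (i + 1) 0) := by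
    rcases Nat.eq_zero_or_pos j with rfl | hj
    · exact IsCellular.self.bar_shift
    · exact IsCellular.self.bar_zero_succ hj
  rcases (Prod.Lex.toLex_le_toLex.1 h) with h | ⟨h, hj⟩
  · exact (h₁.bar_zero_of_le h).bar_of_zero j'
  · dsimp only at h hj
    subst h
    induction j', hj using Nat.le_induction with
    | base => exact .self
    | succ n hn ih =>
      refine .bar_succ ?_ (ih ?_)
      · rcases Nat.eq_zero_or_pos j with rfl | hj
        · exact IsCellular.self.bar_zero_of_le (by omega)
        · exact h₁.bar_zero_of_le (by omega)
      · exact Prod.Lex.toLex_le_toLex.2 (.inr ⟨rfl, hn⟩)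

end Bar

/-! ### The invariant that obstructs cellularity -/

section Chains

variable {R : Type u} [CommRing R]

/-- `X` has no homology below degree `i`, and every cycle of degree `i` extends to a chain of
length `j` along which the differential is multiplication by `r`, that is, to a morphism
from `Σ^i E_j`. -/
def HasChains (r : R) (i j : ℕ) (X : Ch R) : Prop :=
  (∀ n < i, ∀ x : X.X n, X.d n (n - 1) x = 0 → ∃ y, X.d (n + 1) n y = x) ∧
  ∀ x : X.X i, X.d i (i - 1) x = 0 → ∃ c : ∀ n, X.X n, c i = x ∧
    ∀ n, i ≤ n → n < i + j → X.d (n + 1) n (c (n + 1)) = r • c n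

theorem HasChains.of_source {r : R} (hr : r * r = 0) {i j : ℕ} {X Y : Ch R} (f : X ⟶ Y)
    (hf : QuasiIso f) (hX : HasChains r i j X) : HasChains r i j Y := by
  rw [Ch.quasiIso_iff] at hf
  refine ⟨fun n hn y hy => ?_, fun y hy => ?_⟩
  · obtain ⟨x, hx, y', rfl⟩ := hf.2 n y hy
    obtain ⟨x', rfl⟩ := hX.1 n hn x hx
    exact ⟨f.f (n + 1) x' + y', by rw [map_add, Ch.hom_d_apply]⟩
  · obtain ⟨x, hx, y', rfl⟩ := hf.2 i y hy
    obtain ⟨c, rfl, hc⟩ := hX.2 x hx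
    -- The image chain starts at `f x`, not at `f x + d y'`; the homotopy `v`, concentrated in
    -- degree `i + 1`, corrects this.
    let v : ∀ n, Y.X n := Function.update 0 (i + 1) y'
    refine ⟨fun n => f.f n (c n) + Y.d (n + 1) n (v (n + 1)) + r • v n, ?_, fun n hn hn' => ?_⟩
    · simp [v]
    · rw [map_add, map_add, ← Ch.hom_d_apply, hc n hn hn', Ch.d_d_apply, map_smul, map_smul,
        smul_add, smul_add, smul_smul, hr, zero_smul, add_zero, add_zero]

theorem HasChains.of_target {r : R} (hr : r * r = 0) {i j : ℕ} {X Y : Ch R} (f : X ⟶ Y)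
    (hf : QuasiIso f) (hY : HasChains r i j Y) : HasChains r i j X := by
  rw [Ch.quasiIso_iff] at hf
  have hfd : ∀ n (x : X.X n), X.d n (n - 1) x = 0 → Y.d n (n - 1) (f.f n x) = 0 := by
    intro n x hx
    rw [← Ch.hom_d_apply, hx, map_zero]
  refine ⟨fun n hn x hx => ?_, fun x hx => ?_⟩
  · obtain ⟨y, hy⟩ := hY.1 n hn (f.f n x) (hfd n x hx)
    obtain ⟨x', h⟩ := hf.1 n x hx y hy.symm
    exact ⟨x', h.symm⟩
  · obtain ⟨y, hy₀, hy⟩ := hY.2 (f.f i x) (hfd i x hx)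
    -- Lift the chain `y` one degree at a time, together with a homotopy `w` from `y` to the image
    -- of the lift.
    have key : ∀ k ≤ j, ∃ (c : ∀ n, X.X n) (w : ∀ n, Y.X n), c i = x ∧
        (∀ n, i ≤ n → n < i + k → X.d (n + 1) n (c (n + 1)) = r • c n) ∧
        ∀ n, i ≤ n → n ≤ i + k →
          f.f n (c n) = y n + Y.d (n + 1) n (w (n + 1)) + r • w n := by
      intro k
      induction k with
      | zero =>
        refine fun _ => ⟨Function.update 0 i x, 0, by simp, fun n h₁ h₂ => by omega,
          fun n h₁ h₂ => ?_⟩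
        obtain rfl : n = i := by omega
        simp [hy₀]
      | succ k ih =>
        intro hk
        obtain ⟨c, w, hc₀, hc, hw⟩ := ih (by omega)
        have hcyc : X.d (i + k) (i + k - 1) (r • c (i + k)) = 0 := by
          rcases k with _ | k
          · change X.d i (i - 1) (r • c i) = 0
            rw [hc₀, map_smul, hx, smul_zero]
          · rw [map_smul]
            change r • X.d (i + k + 1) (i + k) (c (i + k + 1)) = 0
            rw [hc (i + k) (by omega) (by omega), smul_smul, hr, zero_smul]
        have hfr : f.f (i + k) (r • c (i + k)) =
            Y.d (i + k + 1) (i + k) (y (i + k + 1) + r • w (i + k + 1)) := by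
          rw [map_smul, hw (i + k) (by omega) le_rfl, map_add, hy (i + k) (by omega) (by omega),
            map_smul, smul_add, smul_add, smul_smul, hr, zero_smul, add_zero]
        obtain ⟨x', hx'⟩ := hf.1 _ _ hcyc _ hfr
        -- The image of `x'` differs from the required value by a cycle. Up to a boundary this is
        -- the image of a cycle `e`, and `x' - e` has the same differential as `x'`.
        obtain ⟨e, he, v, hv⟩ := hf.2 (i + k + 1) (f.f _ x' - (y (i + k + 1) + r • w (i + k + 1)))
          (by
            change Y.d (i + k + 1) (i + k) _ = 0
            rw [map_sub, ← Ch.hom_d_apply, ← hx', hfr, sub_self])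
        replace he : X.d (i + k + 1) (i + k) e = 0 := he
        refine ⟨Function.update c (i + k + 1) (x' - e), Function.update w (i + k + 2) v, ?_,
          fun n h₁ h₂ => ?_, fun n h₁ h₂ => ?_⟩
        · rw [Function.update_of_ne (by omega), hc₀]
        · rw [Function.update_of_ne (show n ≠ i + k + 1 by omega)]
          rcases Nat.lt_or_ge n (i + k) with h | h
          · rw [Function.update_of_ne (by omega), hc n h₁ h]
          · obtain rfl : n = i + k := by omega
            rw [Function.update_self, map_sub, he, sub_zero, hx']
        · rw [Function.update_of_ne (show n ≠ i + k + 2 by omega)]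
          rcases Nat.lt_or_ge n (i + k + 1) with h | h
          · rw [Function.update_of_ne (by omega), Function.update_of_ne (by omega),
              hw n h₁ (by omega)]
          · obtain rfl : n = i + k + 1 := by omega
            rw [Function.update_self, Function.update_self, map_sub]
            rw [sub_eq_iff_eq_add] at hv
            rw [hv]
            abel
    obtain ⟨c, w, h₁, h₂, -⟩ := key j le_rfl
    exact ⟨c, h₁, h₂⟩

/-- The obstruction to lifting a cycle to a cycle is its image under the connecting map, in the
homology of `S.X₁` one degree lower. -/
theorem Ch.exists_cycle_lift (S : ShortComplex (Ch R)) (hS : S.ShortExact) {n : ℕ}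
    (h : ∀ m, m + 1 = n → ∀ x : S.X₁.X m, S.X₁.d m (m - 1) x = 0 →
      ∃ y, S.X₁.d (m + 1) m y = x) (z : S.X₃.X n) (hz : S.X₃.d n (n - 1) z = 0) :
    ∃ y : S.X₂.X n, S.X₂.d n (n - 1) y = 0 ∧ S.g.f n y = z := by
  rw [Ch.shortExact_iff] at hS
  obtain ⟨y, rfl⟩ := (hS n).2.1 z
  rcases n with _ | m
  · exact ⟨y, Ch.d_zero_apply _ _, rfl⟩
  · change S.X₃.d (m + 1) m _ = 0 at hz
    rw [← Ch.hom_d_apply] at hz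
    obtain ⟨x, hx⟩ := (hS m).2.2 _ hz
    obtain ⟨x', rfl⟩ := h m rfl x (by
      apply (hS (m - 1)).1
      rw [Ch.hom_d_apply, hx, map_zero, Ch.d_d_apply])
    refine ⟨y - S.f.f (m + 1) x', ?_, ?_⟩
    · change S.X₂.d (m + 1) m _ = 0
      rw [map_sub, ← hx, Ch.hom_d_apply, sub_self]
    · have : S.g.f (m + 1) (S.f.f (m + 1) x') = 0 := by
        rw [← ModuleCat.comp_apply, ← HomologicalComplex.comp_f, S.zero]
        rfl
      rw [map_sub, this, sub_zero]

/-- A cycle of degree at most `i` lifts to a cycle of `S.X₂`, because the obstruction lies below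
degree `i`; bounding elements and chains are then pushed forward. -/
theorem HasChains.quotient {r : R} {i j : ℕ} (S : ShortComplex (Ch R)) (hS : S.ShortExact)
    (h₁ : HasChains r i j S.X₁) (h₂ : HasChains r i j S.X₂) : HasChains r i j S.X₃ := by
  refine ⟨fun n hn z hz => ?_, fun z hz => ?_⟩
  · obtain ⟨y, hy, rfl⟩ := Ch.exists_cycle_lift S hS (fun m hm => h₁.1 m (by omega)) z hz
    obtain ⟨y', rfl⟩ := h₂.1 n hn y hy
    exact ⟨S.g.f _ y', (Ch.hom_d_apply _ _ _ _).symm⟩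
  · obtain ⟨y, hy, rfl⟩ := Ch.exists_cycle_lift S hS (fun m hm => h₁.1 m (by omega)) z hz
    obtain ⟨c, rfl, hc⟩ := h₂.2 y hy
    exact ⟨fun n => S.g.f n (c n), rfl, fun n hn hn' => by
      rw [← Ch.hom_d_apply, hc n hn hn', map_smul]⟩

open Classical in
theorem Ch.exists_sigma_eq_sum {ι : Type u} (X : ι → Ch R) (n : ℕ) (x : (∐ X).X n) :
    ∃ s : Finset ι, x = ∑ a ∈ s, (Sigma.ι X a).f n ((Sigma.π X a).f n x) := by
  have hι : ∀ a (y : (X a).X n), (Sigma.π X a).f n ((Sigma.ι X a).f n y) = y := by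
    intro a y
    rw [← ModuleCat.comp_apply, ← HomologicalComplex.comp_f, Sigma.ι_π_eq_id]
    rfl
  have hι' : ∀ a b (y : (X a).X n), a ≠ b → (Sigma.π X b).f n ((Sigma.ι X a).f n y) = 0 := by
    intro a b y hab
    rw [← ModuleCat.comp_apply, ← HomologicalComplex.comp_f, Sigma.ι_π_of_ne _ hab]
    rfl
  let p : Submodule R ((∐ X).X n) := ⨆ a, LinearMap.range ((Sigma.ι X a).f n).hom
  have hp : ModuleCat.ofHom p.mkQ = 0 := by
    -- Evaluation in degree `n` preserves the coproduct, so a map out of it that kills every summand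
    -- is zero.
    have := isColimitOfPreserves (HomologicalComplex.eval (ModuleCat.{u} R) (ComplexShape.down ℕ) n)
      (coproductIsCoproduct X)
    refine this.hom_ext fun ⟨a⟩ => ?_
    ext y
    exact (Submodule.Quotient.mk_eq_zero p).2 (Submodule.mem_iSup_of_mem a ⟨y, rfl⟩)
  have hx : x ∈ p := (Submodule.Quotient.mk_eq_zero p).1 congr($hp x)
  -- Allowing every larger `t` lets two elements be compared on the union of their index sets.
  suffices ∃ s : Finset ι, ∀ t, s ⊆ t →
      x = ∑ a ∈ t, (Sigma.ι X a).f n ((Sigma.π X a).f n x) by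
    obtain ⟨s, hs⟩ := this
    exact ⟨s, hs s subset_rfl⟩
  induction hx using Submodule.iSup_induction' with
  | mem a x hx =>
    obtain ⟨y, rfl⟩ := hx
    refine ⟨{a}, fun t ht => ?_⟩
    rw [Finset.sum_eq_single_of_mem a (ht (Finset.mem_singleton_self a))]
    · exact congr((Sigma.ι X a).f n $(hι a y)).symm
    · intro b _ hb
      exact congr((Sigma.ι X b).f n $(hι' a b y hb.symm)).trans (map_zero _)
  | zero => exact ⟨∅, fun t _ => by simp⟩
  | add x y _ _ hx hy =>
    obtain ⟨s, hs⟩ := hx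
    obtain ⟨t, ht⟩ := hy
    refine ⟨s ∪ t, fun w hw => ?_⟩
    simp only [map_add, Finset.sum_add_distrib]
    rw [← hs w (Finset.union_subset_left hw), ← ht w (Finset.union_subset_right hw)]

open Classical in
theorem HasChains.sigma {r : R} {i j : ℕ} {ι : Type u} (X : ι → Ch R)
    (hX : ∀ a, HasChains r i j (X a)) : HasChains r i j (∐ X) := by
  have hd : ∀ n (x : (∐ X).X n), (∐ X).d n (n - 1) x = 0 →
      ∀ a, (X a).d n (n - 1) ((Sigma.π X a).f n x) = 0 := by
    intro n x hx a
    rw [← Ch.hom_d_apply, hx, map_zero]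
  refine ⟨fun n hn x hx => ?_, fun x hx => ?_⟩
  · obtain ⟨s, hs⟩ := Ch.exists_sigma_eq_sum X n x
    choose y hy using fun a => (hX a).1 n hn _ (hd n x hx a)
    refine ⟨∑ a ∈ s, (Sigma.ι X a).f (n + 1) (y a), ?_⟩
    rw [map_sum]
    refine (Finset.sum_congr rfl fun a _ => ?_).trans hs.symm
    rw [← Ch.hom_d_apply, hy]
  · obtain ⟨s, hs⟩ := Ch.exists_sigma_eq_sum X i x
    choose c hc hc' using fun a => (hX a).2 _ (hd i x hx a)
    refine ⟨fun n => ∑ a ∈ s, (Sigma.ι X a).f n (c a n), ?_, fun n hn hn' => ?_⟩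
    · simp only [hc]
      exact hs.symm
    · rw [map_sum, Finset.smul_sum]
      refine Finset.sum_congr rfl fun a _ => ?_
      rw [← Ch.hom_d_apply, hc' a n hn hn', map_smul]

theorem IsCellular.hasChains {r : R} (hr : r * r = 0) {i j : ℕ} {A X : Ch R}
    (hA : HasChains r i j A) (hX : IsCellular A X) : HasChains r i j X := by
  induction hX with
  | self => exact hA
  | sum X _ ih => exact .sigma X ih
  | of_source f hf _ ih => exact ih.of_source hr f hf
  | of_target f hf _ ih => exact ih.of_target hr f hf
  | quotient S hS _ _ ih₁ ih₂ => exact .quotient S hS ih₁ ih₂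

theorem hasChains_bar {r : R} (hr : r * r = 0) (i j : ℕ) : HasChains r i j (bar r hr i j) := by
  refine ⟨fun n hn x _ => ⟨0, line.coeff_injective n ?_⟩, fun x _ =>
    ⟨fun n => line.mk n (line.coeff i x), line.mk_coeff i x, fun n hn hn' =>
      line.coeff_injective n ?_⟩⟩
  · rw [line.coeff_of_not (by omega), line.coeff_of_not (by omega)]
  · rw [line.coeff_d, line.coeff_mk, map_smul, line.coeff_mk, if_pos (by omega),
      if_pos (by omega), if_pos (by omega), smul_eq_mul]

/-- The test cycle is the bottom generator. It is not a boundary, because boundaries are killed by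
`r`; and a chain on it longer than `j'` would leave the complex, forcing `r = 0`. -/
theorem le_of_hasChains_bar {r : R} (hr : r * r = 0) (hr₀ : r ≠ 0) {i j i' j' : ℕ}
    (h : HasChains r i j (bar r hr i' j')) : toLex (i, j) ≤ toLex (i', j') := by
  have hcyc : (bar r hr i' j').d i' (i' - 1) (line.mk i' 1) = 0 := by
    rcases i' with _ | i'
    · exact Ch.d_zero_apply _ _
    · apply line.coeff_injective
      rw [line.coeff_of_not (by simp), line.coeff_of_not (by simp)]
  rw [Prod.Lex.toLex_le_toLex]
  by_contra hlt
  rcases Nat.lt_or_ge i' i with hi | hi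
  · obtain ⟨y, hy⟩ := h.1 i' hi _ hcyc
    have := congr(line.coeff i' $hy)
    rw [line.coeff_d, line.coeff_mk, if_pos (by omega), if_pos (by omega)] at this
    exact hr₀ (by linear_combination (line.coeff (i' + 1) y) * hr - r * this)
  · obtain rfl : i = i' := by
      by_contra hne
      exact hlt (.inl (by change i < i'; omega))
    have hj : j' < j := by
      by_contra hj
      exact hlt (.inr ⟨rfl, by change j ≤ j'; omega⟩)
    obtain ⟨c, hc₀, hc⟩ := h.2 _ hcyc
    -- Modulo the annihilator of `r`, all coordinates of the chain equal `1`.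
    have key : ∀ k ≤ j', r * line.coeff (i + k) (c (i + k)) = r := by
      intro k
      induction k with
      | zero =>
        intro _
        change r * line.coeff i (c i) = r
        rw [hc₀, line.coeff_mk, if_pos (by omega), mul_one]
      | succ k ih =>
        intro hk
        have := congr(line.coeff (i + k) $(hc (i + k) (by omega) (by omega)))
        rw [line.coeff_d, if_pos (by omega), map_smul, smul_eq_mul, ih (by omega)] at this
        exact this
    have := congr(line.coeff (i + j') $(hc (i + j') (by omega) (by omega)))
    rw [line.coeff_d, if_pos (by omega), map_smul, smul_eq_mul, key j' le_rfl,
      line.coeff_of_not (by omega), mul_zero] at this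
    exact hr₀ this.symm

theorem isCellular_bar_iff {r : R} (hr : r * r = 0) (hr₀ : r ≠ 0) (i j i' j' : ℕ) :
    IsCellular (bar r hr i j) (bar r hr i' j') ↔ toLex (i, j) ≤ toLex (i', j') :=
  ⟨fun h => le_of_hasChains_bar hr hr₀ (h.hasChains hr (hasChains_bar hr i j)),
    isCellular_bar_of_le⟩

theorem isCellular_sigmaE_iff {r : R} (hr : r * r = 0) (hr₀ : r ≠ 0) (i j i' j' : ℕ) :
    IsCellular (sigmaE r hr i j) (sigmaE r hr i' j') ↔ toLex (i, j) ≤ toLex (i', j') := by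
  obtain ⟨e⟩ := nonempty_sigmaE_iso_bar r hr i j
  obtain ⟨e'⟩ := nonempty_sigmaE_iso_bar r hr i' j'
  rw [← isCellular_bar_iff hr hr₀]
  exact ⟨fun h => ((IsCellular.self.of_iso e.symm).trans h).of_iso e',
    fun h => ((IsCellular.self.of_iso e).trans h).of_iso e'.symm⟩

end Chains

/-! ### Functionals over the local ring -/

section LocalRing

variable {R : Type u} [CommRing R] {r : R}
  {M : Type*} [AddCommGroup M] [Module R M]

theorem exists_mul_of_not_isUnit  [IsLocalRing R]
    (hr : IsLocalRing.maximalIdeal R = Ideal.span {r}) {a : R}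
    (ha : ¬ IsUnit a) : ∃ b, a = r * b := by
  have : a ∈ IsLocalRing.maximalIdeal R := ha
  rw [hr, Ideal.mem_span_singleton] at this
  exact this

theorem Module.Basis.exists_smul_of_repr {ι : Type*} (b : Module.Basis ι R M) {x : M}
    (h : ∀ k, ∃ a, b.repr x k = r * a) : ∃ y, x = r • y := by
  choose a ha using h
  refine ⟨∑ k ∈ (b.repr x).support, a k • b k, ?_⟩
  rw [Finset.smul_sum]
  conv_lhs => rw [← b.linearCombination_repr x, Finsupp.linearCombination_apply, Finsupp.sum]
  exact Finset.sum_congr rfl fun k _ => by rw [ha, mul_smul]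

/-- If no coordinate of `x` were a unit, all would be multiples of `r`. A unit coordinate is
rescaled to `1`. -/
theorem exists_functional_of_not_smul  [IsLocalRing R]
    (hr : IsLocalRing.maximalIdeal R = Ideal.span {r})
    [Module.Free R M] {x : M} (hx : ¬ ∃ y, x = r • y) : ∃ φ : M →ₗ[R] R, φ x = 1 := by
  let b := Module.Free.chooseBasis R M
  obtain ⟨k, hk⟩ : ∃ k, IsUnit (b.repr x k) := by
    by_contra! h
    exact hx (b.exists_smul_of_repr fun k => exists_mul_of_not_isUnit hr (h k))
  obtain ⟨v, hv⟩ := hk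
  refine ⟨(↑v⁻¹ : R) • b.coord k, ?_⟩
  simp [← hv]

/-- Projectivity lifts `φ` through the surjection of `R` onto the ideal `(r)` given by
multiplication by `r`. -/
theorem exists_functional_lift [Module.Projective R M] (φ : M →ₗ[R] R)
    (h : ∀ x, ∃ a, φ x = r * a) : ∃ ψ : M →ₗ[R] R, ∀ x, φ x = r * ψ x := by
  obtain ⟨ψ, hψ⟩ := Module.projective_lifting_property
    (LinearMap.mulLeft R r).rangeRestrict
    (φ.codRestrict (LinearMap.range (LinearMap.mulLeft R r)) fun x => by
      obtain ⟨a, ha⟩ := h x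
      exact ⟨a, ha.symm⟩)
    (LinearMap.surjective_rangeRestrict _)
  exact ⟨ψ, fun x => (congr(($hψ x : R))).symm⟩

end LocalRing

/-! ### Direct summands and assembling splittings -/

section Split

variable {R : Type u} [CommRing R]

theorem exists_iso_biprod_of_retract {B X : Ch R} (i : B ⟶ X) (q : X ⟶ B) (h : IsIso (i ≫ q)) :
    ∃ X' : Ch R, Nonempty (X ≅ B ⊞ X') := by
  have : IsSplitMono i := ⟨⟨⟨q ≫ inv (i ≫ q), by rw [← Category.assoc, IsIso.hom_inv_id]⟩⟩⟩
  exact ⟨_, ⟨biprod.uniqueUpToIso B _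
    (isBilimitBinaryBiconeOfIsSplitMonoOfCokernel (cokernelIsCokernel i))⟩⟩

/-- The degreewise form of a decomposition into two summands. -/
noncomputable def Ch.biprodEquiv {X B X' : Ch R} (e : X ≅ B ⊞ X') (n : ℕ) :
    X.X n ≃ₗ[R] (B.X n × X'.X n) :=
  ((HomologicalComplex.eval (ModuleCat.{u} R) (ComplexShape.down ℕ) n).mapIso e ≪≫
    HomologicalComplex.biprodXIso B X' n ≪≫ ModuleCat.biprodIsoProd _ _).toLinearEquiv

theorem Ch.acyclic_of_iso {X Y : Ch R} (e : X ≅ Y) (hX : X.Acyclic) : Y.Acyclic := by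
  have h := (Ch.quasiIso_iff e.hom).1 inferInstance
  rw [Ch.acyclic_iff] at hX ⊢
  intro n y hy
  obtain ⟨x, hx, y', rfl⟩ := h.2 n y hy
  obtain ⟨x', rfl⟩ := hX n x hx
  exact ⟨e.hom.f _ x' + y', by rw [map_add, Ch.hom_d_apply]⟩

theorem Ch.acyclic_biprod {X Y : Ch R} (hX : X.Acyclic) (hY : Y.Acyclic) : (X ⊞ Y).Acyclic := by
  let S := ShortComplex.mk (biprod.inl : X ⟶ X ⊞ Y) biprod.snd (by simp)
  have hS : S.Splitting := { r := biprod.fst, s := biprod.inr }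
  exact hS.shortExact.acyclic_X₂ hX hY

variable {r : R} {hr : r * r = 0}

theorem Splitting.of_acyclic {X : Ch R} (hX : X.Acyclic) : Nonempty (Splitting r hr X) := by
  let F : Fin 0 → Ch R := fun a => a.elim0
  have hF : IsZero (∐ F) := by
    rw [IsZero.iff_id_eq_zero]
    exact Sigma.hom_ext _ _ fun a => a.elim0
  exact ⟨{ P := X
           acyclic := hX
           N := 0
           pair := fun a => a.elim0
           iso := { hom := biprod.inl
                    inv := biprod.fst
                    inv_hom_id := biprod.hom_ext' _ _ (by simp)
                      (Sigma.hom_ext _ _ fun a => a.elim0) } }⟩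

theorem Splitting.of_acyclic_biprod {D X X' : Ch R} (hD : D.Acyclic) (e : X ≅ D ⊞ X')
    (h : Nonempty (Splitting r hr X')) : Nonempty (Splitting r hr X) := by
  obtain ⟨s⟩ := h
  exact ⟨{ P := D ⊞ s.P
           acyclic := Ch.acyclic_biprod hD s.acyclic
           N := s.N
           pair := s.pair
           iso := e ≪≫ biprod.mapIso (Iso.refl _) s.iso ≪≫ (biprod.associator _ _ _).symm }⟩

/-- A finite sum with its first summand split off. -/
noncomputable def sigmaSuccIso {n : ℕ} (F : Fin (n + 1) → Ch R) :
    F 0 ⊞ (∐ fun a : Fin n => F a.succ) ≅ ∐ F where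
  hom := biprod.desc (Sigma.ι F 0) (Sigma.desc fun a => Sigma.ι F a.succ)
  inv := Sigma.desc (Fin.cases biprod.inl
    fun a => Sigma.ι (fun a : Fin n => F a.succ) a ≫ biprod.inr)
  hom_inv_id := by
    apply biprod.hom_ext'
    · simp
    · refine Sigma.hom_ext _ _ fun a => ?_
      simp
  inv_hom_id := by
    refine Sigma.hom_ext _ _ fun a => ?_
    refine Fin.cases ?_ (fun a => ?_) a <;> simp

theorem Splitting.of_sigmaE_biprod {X X' : Ch R} (i j : ℕ) (e : X ≅ sigmaE r hr i j ⊞ X')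
    (h : Nonempty (Splitting r hr X')) : Nonempty (Splitting r hr X) := by
  obtain ⟨s⟩ := h
  let pair : Fin (s.N + 1) → ℕ ×ₗ ℕ := Fin.cons (toLex (i, j)) s.pair
  exact ⟨{ P := s.P
           acyclic := s.acyclic
           N := s.N + 1
           pair := pair
           iso := e ≪≫ biprod.mapIso (Iso.refl _) (s.iso ≪≫ biprod.braiding _ _) ≪≫
            (biprod.associator _ _ _).symm ≪≫ biprod.braiding _ _ ≪≫
            biprod.mapIso (Iso.refl _)
              (sigmaSuccIso fun a => sigmaE r hr (ofLex (pair a)).1 (ofLex (pair a)).2) }⟩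

end Split

/-! ### Decomposition of perfect complexes -/

section Decompose

open Classical

variable {R : Type u} [CommRing R]

/-- A bounded complex of finitely generated projective modules, with an explicit bound. -/
structure IsBoundedProjective (N : ℕ) (X : Ch R) : Prop where
  projective : ∀ n, Module.Projective R (X.X n)
  finite : ∀ n, Module.Finite R (X.X n)
  subsingleton : ∀ n, N ≤ n → Subsingleton (X.X n)

theorem IsPerfect.exists_isBoundedProjective {X : Ch R} (hX : IsPerfect X) :
    ∃ N, IsBoundedProjective N X := by
  have := hX.2
  have hsurj : ∀ n, Function.Surjective (DirectSum.component R ℕ (fun n => X.X n) n) :=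
    fun n x => ⟨DirectSum.lof R ℕ (fun n => X.X n) n x, DirectSum.component.lof_self (M := fun n => X.X n) R n x⟩
  obtain ⟨S, hS⟩ := Module.Finite.fg_top (R := R) (M := DirectSum ℕ fun n => X.X n)
  -- Finitely many generators have finite supports; beyond the largest index occurring there, every
  -- component map vanishes.
  refine ⟨(S.sup fun x => (DFinsupp.support x).sup id) + 1, hX.1,
    fun n => Module.Finite.of_surjective _ (hsurj n), fun n hn => ?_⟩
  have h0 : DirectSum.component R ℕ (fun n => X.X n) n = 0 := by
    refine LinearMap.ext_on hS fun x hx => ?_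
    by_contra hne
    have h₁ : n ∈ DFinsupp.support x := DFinsupp.mem_support_iff.2 hne
    have h₂ : n ≤ (DFinsupp.support x).sup id := Finset.le_sup (f := id) h₁
    have h₃ := Finset.le_sup (f := fun x : DirectSum ℕ fun n => X.X n =>
      (DFinsupp.support x).sup id) hx
    have := h₂.trans h₃
    omega
  refine ⟨fun x y => ?_⟩
  obtain ⟨x, rfl⟩ := hsurj n x
  obtain ⟨y, rfl⟩ := hsurj n y
  rw [h0]
  rfl

theorem IsBoundedProjective.of_biprod {N : ℕ} {X B X' : Ch R} (hX : IsBoundedProjective N X)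
    (e : X ≅ B ⊞ X') : IsBoundedProjective N B ∧ IsBoundedProjective N X' := by
  have h := hX.projective
  have h' := hX.finite
  constructor
  · refine ⟨fun n => ?_, fun n => ?_, fun n hn => ?_⟩
    · exact .of_split ((Ch.biprodEquiv e n).symm.toLinearMap ∘ₗ LinearMap.inl R _ _)
        (LinearMap.fst R _ _ ∘ₗ (Ch.biprodEquiv e n).toLinearMap) (by ext; simp)
    · exact .of_surjective (LinearMap.fst R _ _ ∘ₗ (Ch.biprodEquiv e n).toLinearMap)
        (Prod.fst_surjective.comp (Ch.biprodEquiv e n).surjective)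
    · have := hX.subsingleton n hn
      exact (Prod.fst_surjective.comp (Ch.biprodEquiv e n).surjective).subsingleton
  · refine ⟨fun n => ?_, fun n => ?_, fun n hn => ?_⟩
    · exact .of_split ((Ch.biprodEquiv e n).symm.toLinearMap ∘ₗ LinearMap.inr R _ _)
        (LinearMap.snd R _ _ ∘ₗ (Ch.biprodEquiv e n).toLinearMap) (by ext; simp)
    · exact .of_surjective (LinearMap.snd R _ _ ∘ₗ (Ch.biprodEquiv e n).toLinearMap)
        (Prod.snd_surjective.comp (Ch.biprodEquiv e n).surjective)
    · have := hX.subsingleton n hn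
      exact (Prod.snd_surjective.comp (Ch.biprodEquiv e n).surjective).subsingleton

/-- Total rank is the induction measure for splitting off nonzero summands. -/
theorem IsBoundedProjective.sum_finrank_lt [IsLocalRing R] {N : ℕ} {X B X' : Ch R}
    (hX : IsBoundedProjective N X) (e : X ≅ B ⊞ X') {n : ℕ} (hn : Nontrivial (B.X n)) :
    ∑ n ∈ Finset.range N, Module.finrank R (X'.X n) <
      ∑ n ∈ Finset.range N, Module.finrank R (X.X n) := by
  obtain ⟨hB, hX'⟩ := hX.of_biprod e
  have free : ∀ {Y : Ch R}, IsBoundedProjective N Y → ∀ n, Module.Free R (Y.X n) := by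
    intro Y hY n
    have := hY.projective n
    have := hY.finite n
    exact Module.free_of_flat_of_isLocalRing
  have key : ∀ n, Module.finrank R (X.X n) =
      Module.finrank R (B.X n) + Module.finrank R (X'.X n) := by
    intro n
    have := free hB n
    have := free hX' n
    have := hB.finite n
    have := hX'.finite n
    rw [(Ch.biprodEquiv e n).finrank_eq, Module.finrank_prod]
  simp_rw [key]
  refine Finset.sum_lt_sum (fun _ _ => Nat.le_add_left _ _) ⟨n, ?_, ?_⟩
  · rw [Finset.mem_range]
    by_contra h
    have := hB.subsingleton n (not_lt.1 h)
    exact not_subsingleton _ this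
  · have := free hB n
    have := hB.finite n
    have := (Module.finrank_pos_iff_of_free R (B.X n)).2 hn
    omega

/-- The acyclic complex `R = R` in degrees `n + 1` and `n`. -/
noncomputable abbrev disc (R : Type u) [CommRing R] (n : ℕ) : Ch R :=
  line (fun k => k = n ∨ k = n + 1) (fun _ => 1) (fun _ _ _ _ => by omega)

theorem acyclic_disc (n : ℕ) : (disc R n).Acyclic := by
  rw [Ch.acyclic_iff]
  intro k x hx
  refine ⟨line.mk (k + 1) (line.coeff k x), line.coeff_injective k ?_⟩
  rw [line.coeff_d, line.coeff_mk]
  by_cases hk : k = n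
  · rw [if_pos (.inl hk), if_pos (.inr (by omega)), one_mul]
  · by_cases hk' : k = n + 1
    · have := line.cycle hx hk'.symm (.inl rfl)
      rw [one_mul] at this
      rw [this, ite_self, mul_zero, ite_self]
    · rw [line.coeff_of_not (by omega), ite_self, mul_zero, ite_self]

theorem line.nontrivial [Nontrivial R] {p : ℕ → Prop} {c : ℕ → R}
    {h : ∀ n, p n → p (n + 1) → p (n + 2) → c n * c (n + 1) = 0} {n : ℕ} (hn : p n) :
    Nontrivial ((line p c h).X n) := by
  refine ⟨line.mk n 1, 0, fun H => one_ne_zero (α := R) ?_⟩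
  have := congr(line.coeff n $H)
  rwa [line.coeff_mk, if_pos hn, map_zero] at this

/-- The elements `x`, `d x` and the functionals `φ ∘ d`, `φ` map the disc into `X` and back, with
identity composite. -/
theorem exists_iso_disc_biprod {X : Ch R} {n : ℕ} (x : X.X (n + 1)) (φ : X.X n →ₗ[R] R)
    (hφ : φ (X.d (n + 1) n x) = 1) : ∃ X' : Ch R, Nonempty (X ≅ disc R n ⊞ X') := by
  let y : ∀ k, X.X k := Function.update (Function.update 0 n (X.d (n + 1) n x)) (n + 1) x
  let Φ : ∀ k, X.X k →ₗ[R] R :=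
    Function.update (Function.update 0 n φ) (n + 1) (φ.comp (X.d (n + 1) n).hom)
  have y₀ : y n = X.d (n + 1) n x := by simp [y]
  have y₁ : y (n + 1) = x := by simp [y]
  have Φ₀ : Φ n = φ := by simp [Φ]
  have Φ₁ : ∀ z, Φ (n + 1) z = φ (X.d (n + 1) n z) := by simp [Φ]
  refine exists_iso_biprod_of_retract (line.desc y ?_) (line.lift Φ ?_)
    (line.isIso_desc_lift y _ Φ _ ?_)
  · intro k hk
    rcases hk with hk | hk
    · subst hk
      rw [if_neg (by omega), y₀, Ch.d_d_apply]
    · obtain rfl : k = n := by omega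
      rw [if_pos (.inl rfl), y₀, y₁, one_smul]
  · intro k hk z
    rcases hk with rfl | rfl
    · rw [if_pos (.inr rfl), Φ₀, Φ₁, one_mul]
    · rw [if_neg (by omega), Φ₁, Ch.d_d_apply, map_zero]
  · intro k hk
    rcases hk with rfl | rfl
    · rw [Φ₀, y₀, hφ]
      exact isUnit_one
    · rw [Φ₁, y₁, hφ]
      exact isUnit_one

/-- If `d x = r x'` is nonzero, then `x'` is again outside `rX`, because `r * r = 0`. The descent
stops at the first cycle met, at the latest in degree zero. -/
theorem exists_chain_down {r : R} (hr : r * r = 0) {X : Ch R}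
    (hmin : ∀ n (x : X.X (n + 1)), ∃ y, X.d (n + 1) n x = r • y) :
    ∀ (b : ℕ) (x : X.X b), (¬ ∃ z, x = r • z) → ∃ i ≤ b, ∃ y : ∀ n, X.X n, y b = x ∧
      (¬ ∃ z, y i = r • z) ∧
      ∀ n, i ≤ n + 1 → n + 1 ≤ b → X.d (n + 1) n (y (n + 1)) = if i ≤ n then r • y n else 0 := by
  intro b
  induction b with
  | zero =>
    intro x hx
    exact ⟨0, le_rfl, Function.update 0 0 x, by simp, by simpa using hx, fun n _ h => by omega⟩
  | succ b ih =>
    intro x hx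
    by_cases hd : X.d (b + 1) b x = 0
    · refine ⟨b + 1, le_rfl, Function.update 0 (b + 1) x, by simp, by simpa using hx,
        fun n h₁ h₂ => ?_⟩
      obtain rfl : n = b := by omega
      rw [Function.update_self, hd, if_neg (by omega)]
    · obtain ⟨x', hx'⟩ := hmin b x
      obtain ⟨i, hi, y, rfl, hyi, hy⟩ := ih x' (by
        rintro ⟨z, rfl⟩
        rw [smul_smul, hr, zero_smul] at hx'
        exact hd hx')
      refine ⟨i, by omega, Function.update y (b + 1) x, by simp, ?_, fun n h₁ h₂ => ?_⟩
      · rwa [Function.update_of_ne (by omega)]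
      · rw [Function.update_of_ne (show n ≠ b + 1 by omega)]
        by_cases hn : n = b
        · subst hn
          rw [Function.update_self, hx', if_pos hi]
        · rw [Function.update_of_ne (by omega), hy n h₁ (by omega)]

/-- Each `φ ∘ d` takes values in `(r)` and so factors as `r ψ`. Only degrees from `i` upwards
matter; the values below are fillers. -/
theorem exists_functionals_up {r : R} {X : Ch R} (hproj : ∀ n, Module.Projective R (X.X n))
    (hmin : ∀ n (x : X.X (n + 1)), ∃ y, X.d (n + 1) n x = r • y) (i : ℕ) (φ : X.X i →ₗ[R] R) :
    ∃ Φ : ∀ n, X.X n →ₗ[R] R, Φ i = φ ∧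
      ∀ n, i ≤ n → ∀ x, Φ n (X.d (n + 1) n x) = r * Φ (n + 1) x := by
  have lift : ∀ n (φ : X.X n →ₗ[R] R), ∃ ψ : X.X (n + 1) →ₗ[R] R,
      ∀ x, φ (X.d (n + 1) n x) = r * ψ x := by
    intro n φ
    refine exists_functional_lift (φ.comp (X.d (n + 1) n).hom) fun x => ?_
    obtain ⟨y, hy⟩ := hmin n x
    refine ⟨φ y, ?_⟩
    change φ (X.d (n + 1) n x) = _
    rw [hy, map_smul, smul_eq_mul]
  choose L hL using lift
  let S : ∀ n, X.X n →ₗ[R] R := Function.update 0 i φ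
  let Φ : ∀ n, X.X n →ₗ[R] R := fun n =>
    Nat.rec (S 0) (fun n Ψ => if n + 1 ≤ i then S (n + 1) else L n Ψ) n
  have hΦ : ∀ n, Φ (n + 1) = if n + 1 ≤ i then S (n + 1) else L n (Φ n) := fun n => rfl
  refine ⟨Φ, ?_, fun n hn x => ?_⟩
  · have hS : S i = φ := by simp [S]
    rw [← hS]
    cases i with
    | zero => rfl
    | succ i => rw [hΦ, if_pos le_rfl]
  · rw [hΦ, if_neg (by omega), hL]

/-- The chain going down gives a map from `Σ^i E_j`, the functionals going up a map to it. The
composite is invertible because its entries are units. -/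
theorem exists_iso_bar_biprod [IsLocalRing R] {r : R}
    (hrm : IsLocalRing.maximalIdeal R = Ideal.span {r}) (hr : r * r = 0) (hr₀ : r ≠ 0) {X : Ch R}
    (hfree : ∀ n, Module.Free R (X.X n))
    (hmin : ∀ n (x : X.X (n + 1)), ∃ y, X.d (n + 1) n x = r • y) {b : ℕ}
    (hb : Nontrivial (X.X b)) (hb' : Subsingleton (X.X (b + 1))) :
    ∃ (i j : ℕ) (X' : Ch R), Nonempty (X ≅ bar r hr i j ⊞ X') := by
  obtain ⟨x, hx⟩ : ∃ x : X.X b, ¬ ∃ z, x = r • z := by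
    by_contra! H
    refine not_subsingleton (X.X b) (subsingleton_of_forall_eq 0 fun x => ?_)
    obtain ⟨y, rfl⟩ := H x
    obtain ⟨z, rfl⟩ := H y
    rw [smul_smul, hr, zero_smul]
  obtain ⟨i, hi, y, -, hyi, hy⟩ := exists_chain_down hr hmin b x hx
  obtain ⟨j, rfl⟩ := Nat.exists_eq_add_of_le hi
  obtain ⟨φ, hφ⟩ := exists_functional_of_not_smul hrm hyi
  obtain ⟨Φ, rfl, hΦ⟩ := exists_functionals_up (fun n => inferInstance) hmin i φ
  -- Consecutive entries agree after multiplication by `r`. A nonunit is killed by `r`, while a unit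
  -- is not.
  have hunit : ∀ k ≤ j, IsUnit (Φ (i + k) (y (i + k))) := by
    intro k
    induction k with
    | zero =>
      intro _
      change IsUnit (Φ i (y i))
      rw [hφ]
      exact isUnit_one
    | succ k ih =>
      intro hk
      by_contra hnu
      obtain ⟨a, ha⟩ := exists_mul_of_not_isUnit hrm hnu
      have := hΦ (i + k) (by omega) (y (i + k + 1))
      rw [hy (i + k) (by omega) (by omega), if_pos (by omega), map_smul, smul_eq_mul] at this
      change _ = r * Φ (i + (k + 1)) (y (i + (k + 1))) at this
      rw [ha, ← mul_assoc, hr, zero_mul] at this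
      exact hr₀ ((ih (by omega)).mul_left_eq_zero.1 this)
  refine ⟨i, j, exists_iso_biprod_of_retract (line.desc y ?_) (line.lift Φ ?_)
    (line.isIso_desc_lift y _ Φ _ ?_)⟩
  · intro n hn
    beta_reduce at hn
    rw [hy n hn.1 hn.2]
    by_cases h : i ≤ n
    · rw [if_pos h, if_pos ⟨h, by omega⟩]
    · rw [if_neg h, if_neg fun h' => h h'.1]
  · intro n hn z
    split_ifs with h
    · exact hΦ n hn.1 z
    -- At the top of the chain there is nothing above, so the functionals commute with the
    -- differentials.
    · obtain rfl : n = i + j := by omega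
      rw [Subsingleton.elim z 0, map_zero, map_zero]
  · intro n hn
    obtain ⟨k, rfl⟩ := Nat.exists_eq_add_of_le hn.1
    exact hunit k (by omega)

theorem IsBoundedProjective.nonempty_splitting [IsLocalRing R] {r : R}
    (hrm : IsLocalRing.maximalIdeal R = Ideal.span {r}) (hr : r * r = 0) (hr₀ : r ≠ 0) {N : ℕ}
    (X : Ch R) (hX : IsBoundedProjective N X) : Nonempty (Splitting r hr X) := by
  induction hm : ∑ n ∈ Finset.range N, Module.finrank R (X.X n) using Nat.strong_induction_on
    generalizing X with
  | _ m ih =>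
    subst hm
    have hfree : ∀ n, Module.Free R (X.X n) := fun n => by
      have := hX.projective n
      have := hX.finite n
      exact Module.free_of_flat_of_isLocalRing
    by_cases hmin : ∀ n (x : X.X (n + 1)), ∃ y, X.d (n + 1) n x = r • y
    · by_cases h0 : ∀ n, Subsingleton (X.X n)
      · refine Splitting.of_acyclic ((Ch.acyclic_iff X).2 fun n x _ => ⟨0, ?_⟩)
        have := h0 n
        exact Subsingleton.elim _ _
      · have hex : ∃ M, ∀ n, M ≤ n → Subsingleton (X.X n) := ⟨N, hX.subsingleton⟩
        obtain ⟨b, hb⟩ : ∃ b, Nat.find hex = b + 1 := by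
          refine Nat.exists_eq_succ_of_ne_zero fun h => h0 fun n => ?_
          exact Nat.find_spec hex n (by omega)
        have hb₁ : Subsingleton (X.X (b + 1)) := Nat.find_spec hex _ hb.le
        have hb₀ : Nontrivial (X.X b) := by
          rw [← not_subsingleton_iff_nontrivial]
          intro h
          refine Nat.find_min hex (m := b) (by omega) fun n hn => ?_
          rcases hn.eq_or_lt with rfl | hn
          · exact h
          · exact Nat.find_spec hex n (by omega)
        obtain ⟨i, j, X', ⟨e⟩⟩ := exists_iso_bar_biprod hrm hr hr₀ hfree hmin hb₀ hb₁
        obtain ⟨e'⟩ := nonempty_sigmaE_iso_bar r hr i j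
        refine Splitting.of_sigmaE_biprod i j (e ≪≫ biprod.mapIso e'.symm (Iso.refl _))
          (ih _ (hX.sum_finrank_lt e (line.nontrivial (n := i) (by omega))) X'
            (hX.of_biprod e).2 rfl)
    · push Not at hmin
      obtain ⟨n, x, hx⟩ := hmin
      obtain ⟨φ, hφ⟩ := exists_functional_of_not_smul hrm (x := X.d (n + 1) n x)
        (by simpa using hx)
      obtain ⟨X', ⟨e⟩⟩ := exists_iso_disc_biprod x φ hφ
      exact Splitting.of_acyclic_biprod (acyclic_disc n) e
        (ih _ (hX.sum_finrank_lt e (line.nontrivial (n := n) (.inl rfl))) X'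
          (hX.of_biprod e).2 rfl)

end Decompose

/-! ### Contractibility, independence of the splitting, and the theorem -/

section Main

variable {R : Type u} [CommRing R]

theorem IsContractible.acyclic {X : Ch R} (hX : IsContractible X) : X.Acyclic := by
  obtain ⟨h⟩ := hX
  intro n
  rw [HomologicalComplex.exactAt_iff_isZero_homology, IsZero.iff_id_eq_zero]
  simpa using h.homologyMap_eq n

/-- An acyclic complex of projectives is a projective resolution of zero, hence homotopy equivalent
to the zero complex. -/
theorem Ch.isContractible_of_acyclic {X : Ch R} (hX : X.Acyclic)
    (hproj : ∀ n, Module.Projective R (X.X n)) : IsContractible X := by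
  have h0 : ((ChainComplex.single₀ (ModuleCat.{u} R)).obj 0).Acyclic :=
    Ch.acyclic_of_isZero (Functor.map_isZero _ (isZero_zero _))
  let P : ProjectiveResolution (0 : ModuleCat.{u} R) :=
    { complex := X
      projective := fun n => (IsProjective.iff_projective _).1 (hproj n)
      π := 0
      quasiIso := Ch.quasiIso_of_acyclic hX h0 _ }
  let Q : ProjectiveResolution (0 : ModuleCat.{u} R) :=
    { complex := 0
      projective := fun n => by
        have : IsZero ((0 : Ch R).X n) := Functor.map_isZero
          (HomologicalComplex.eval (ModuleCat.{u} R) (ComplexShape.down ℕ) n) (isZero_zero _)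
        exact this.projective
      π := 0
      quasiIso := Ch.quasiIso_of_acyclic (Ch.acyclic_of_isZero (isZero_zero _)) h0 _ }
  have e := ProjectiveResolution.homotopyEquiv P Q
  have h : e.hom ≫ e.inv = 0 := by
    rw [(isZero_zero (Ch R)).eq_of_tgt e.hom 0, zero_comp]
  exact ⟨e.homotopyHomInvId.symm.trans (Homotopy.ofEq h)⟩

theorem Splitting.N_pos {r : R} {hr : r * r = 0} {X : Ch R} (s : Splitting r hr X)
    (hproj : ∀ n, Module.Projective R (X.X n)) (hX : ¬ IsContractible X) : 0 < s.N := by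
  rw [Nat.pos_iff_ne_zero]
  intro h0
  have hz : (∐ fun a => sigmaE r hr (ofLex (s.pair a)).1 (ofLex (s.pair a)).2).Acyclic := by
    apply Ch.acyclic_of_isZero
    rw [IsZero.iff_id_eq_zero]
    exact Sigma.hom_ext _ _ fun a => (Fin.cast h0 a).elim0
  exact hX (Ch.isContractible_of_acyclic
    (Ch.acyclic_of_iso s.iso.symm (Ch.acyclic_biprod s.acyclic hz)) hproj)

/-- The minimal summand is a retract of `X`; conversely it builds every other summand by part 1, and
the acyclic part comes for free. -/
theorem Splitting.cellularClass_eq {r : R} {hr : r * r = 0} {X : Ch R} (s : Splitting r hr X)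
    (hr₀ : r ≠ 0) {p : ℕ ×ₗ ℕ} (hp : IsLeast s.pairs p) :
    cellularClass X = cellularClass (sigmaE r hr (ofLex p).1 (ofLex p).2) := by
  obtain ⟨⟨a, rfl⟩, hle⟩ := hp
  let F : Fin s.N → Ch R := fun a => sigmaE r hr (ofLex (s.pair a)).1 (ofLex (s.pair a)).2
  refine _root_.cellularClass_eq ?_ ?_
  · exact IsCellular.self.of_retract (Sigma.ι F a ≫ biprod.inr ≫ s.iso.inv)
      (s.iso.hom ≫ biprod.snd ≫ Sigma.π F a) (by simp [F, Sigma.ι_π_eq_id])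
  · refine IsCellular.of_iso (.biprod (.of_acyclic s.acyclic) (.sigma F fun b => ?_)) s.iso.symm
    exact (isCellular_sigmaE_iff hr hr₀ _ _ _ _).2 (hle ⟨b, rfl⟩)

theorem Splitting.exists_isLeast {r : R} {hr : r * r = 0} {X : Ch R} (s : Splitting r hr X)
    (hN : 0 < s.N) : ∃ p, IsLeast s.pairs p := by
  have : Nonempty (Fin s.N) := ⟨⟨0, hN⟩⟩
  obtain ⟨a, ha⟩ := Finite.exists_min s.pair
  exact ⟨s.pair a, ⟨a, rfl⟩, by rintro _ ⟨b, rfl⟩; exact ha b⟩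

theorem theorem5p3 {R : Type u} [CommRing R] [IsLocalRing R] (r : R)
    (hr : IsLocalRing.maximalIdeal R = Ideal.span {r})
    (hsq : IsLocalRing.maximalIdeal R ^ 2 = ⊥)
    (hne : IsLocalRing.maximalIdeal R ≠ ⊥) :
    (∀ i j i' j' : ℕ,
      IsCellular (sigmaE r (generator_mul_self hr hsq) i j)
          (sigmaE r (generator_mul_self hr hsq) i' j') ↔
        toLex (i, j) ≤ toLex (i', j')) ∧
    (∀ X : Ch R, IsPerfect X →
      Nonempty (Splitting r (generator_mul_self hr hsq) X) ∧
      (¬ IsContractible X →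
        ∃ p : ℕ ×ₗ ℕ,
          (∀ s : Splitting r (generator_mul_self hr hsq) X, IsLeast s.pairs p) ∧
          cellularClass X =
            cellularClass (sigmaE r (generator_mul_self hr hsq) (ofLex p).1 (ofLex p).2)) ∧
      (IsContractible X → cellularClass X = cellularClass (0 : Ch R))) := by
  have hr₀ : r ≠ 0 := by
    rintro rfl
    exact hne (by rw [hr, Ideal.span_singleton_eq_bot])
  have hrr := generator_mul_self hr hsq
  refine ⟨isCellular_sigmaE_iff hrr hr₀, fun X hX => ?_⟩
  obtain ⟨N, hN⟩ := hX.exists_isBoundedProjective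
  have hs := hN.nonempty_splitting hr hrr hr₀
  refine ⟨hs, fun hc => ?_, fun hc => ?_⟩
  · obtain ⟨s⟩ := hs
    obtain ⟨p, hp⟩ := s.exists_isLeast (s.N_pos hX.1 hc)
    refine ⟨p, fun t => ?_, s.cellularClass_eq hr₀ hp⟩
    obtain ⟨q, hq⟩ := t.exists_isLeast (t.N_pos hX.1 hc)
    -- Two splittings give minimal summands with the same cellular class, so part 1 and antisymmetry
    -- identify their pairs.
    have h := (s.cellularClass_eq hr₀ hp).symm.trans (t.cellularClass_eq hr₀ hq)
    have h₁ : p ≤ q := (isCellular_sigmaE_iff hrr hr₀ _ _ _ _).1 (.of_cellularClass_eq h)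
    have h₂ : q ≤ p := (isCellular_sigmaE_iff hrr hr₀ _ _ _ _).1 (.of_cellularClass_eq h.symm)
    rwa [le_antisymm h₁ h₂]
  · exact cellularClass_eq (.of_acyclic (Ch.acyclic_of_isZero (isZero_zero _)))
      (.of_acyclic hc.acyclic)

end Main
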